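/- **Setting.** Let $\alpha,\rho>0$. A probability distribution $D$ on $\mathbb R^d$ is *$(\alpha,\rho)$-semi-product* if for $\eta\sim D$: (1) each coordinate $\eta_j$ is symmetric about $0$; (2) $\mathbb P(|\eta_j|\le\rho)\ge\alpha$ for every $j\in[d]$; (3) the vectors $(\operatorname{sign}\eta_j)_{j\le d}$ and $(|\eta_j|)_{j\le d}$ are independent, and $\operatorname{sign}\eta_1,\dots,\operatorname{sign}\eta_d$ are mutually independent (with $\operatorname{sign}0=0$). Points $y_1,\dots,y_n$ are an *$\epsilon$-corruption* of $y_1^*,\dots,y_n^*$ if $y_i=y_i^*$ for at least $(1-\epsilon)n$ indices $i$. Let $$\mathcal W_\epsilon=\Big\{w\in\mathbb R^n : 0\le w_i\le \tfrac1n \text{ for all } i,\ \sum_{i=1}^n\big|w_i-\tfrac1n\big|\le\epsilon\Big\}.$$ Let $\Phi$ be the Huber loss with parameter $h=2$, that is $\Phi(t)=\tfrac12t^2$ for $|t|\le 2$ and $\Phi(t)=2(|t|-1)$ otherwise, let $F(x)=\sum_{j=1}^d\Phi(x_j)$ and let $f=\nabla F$, so that $f(x)_j=x_j$ if $|x_j|\le2$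 and $f(x)_j=2\operatorname{sign}(x_j)$ otherwise. For points $y_1,\dots,y_n$ and $w\in\mathcal W_\epsilon$ let $\hat\mu^w$ be a minimizer over $\mu\in\mathbb R^d$ of $\sum_{i=1}^n w_iF(\mu-y_i)$, and let $\Sigma_f^w=\sum_{i=1}^n w_i f(y_i-\hat\mu^w)f(y_i-\hat\mu^w)^{\top}$. Vectors carry the Euclidean norm and matrices the spectral norm. **Theorem.** There are absolute constants $C,K>0$ such that the following holds. Let $\alpha,\epsilon>0$ with $\epsilon\le\alpha/100$, let $\delta\in(0,1)$, and assume that $d\ge2$ or $\delta\le\tfrac12$. Let $D$ be an $(\alpha,1)$-semi-product distribution on $\mathbb R^d$, let $\mu^*\in\mathbb R^d$, let $$n\ \ge\ C\Big(\frac{d\log d}{\alpha^4}+\frac{\log(1/\delta)}{\alpha^2}\Big),$$ (with $d \log d := 0$ for $d=0$), let $\eta_1^*,\dots,\eta_n^*$ be i.i.d. from $D$, and let $y_i^*=\mu^*+\eta_i^*$. Then, with probability at least $1-\delta$ over $\eta_1^*,\dots,\eta_n^*$, simultaneously for every $\epsilon$-corruption $y_1,\dots,y_n$ of $y_1^*,\dots,y_n^*$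 and every $w\in\mathcal W_\epsilon$, a minimizer $\hat\mu^w$ exists, and every minimizer satisfies $$\|\hat\mu^w-\mu^*\|\le K\left(\sqrt{\frac{d\log d+\log(1/\delta)}{\alpha^2n}}+\frac1{\alpha^{3/2}}\sqrt{\epsilon\Big(\big\|\Sigma_f^w-\mathbb E_{\eta\sim D}f(\eta)f(\eta)^\top\big\|+\epsilon\log(1/\epsilon)\Big)}\right).$$ -/

import Mathlib

open MeasureTheory ProbabilityTheory

namespace HuberLocation

noncomputable section

/-- The noise law `D` on `ℝ^d` is an `(α, ρ)`-semi-product distribution. -/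
structure IsSemiProduct {d : ℕ} (α ρ : ℝ) (D : Measure (EuclideanSpace ℝ (Fin d))) : Prop where
  /-- every coordinate is symmetric about `0` -/
  symm : ∀ j, D.map (fun x => -x j) = D.map (fun x => x j)
  /-- every coordinate has mass at least `α` in `[-ρ, ρ]` -/
  small : ∀ j, α ≤ D.real {x | |x j| ≤ ρ}
  /-- the vector of signs is independent of the vector of absolute values -/
  indep_sign_abs : IndepFun (fun x j => Real.sign (x j)) (fun x j => |x j|) D
  /-- the signs of the coordinates are mutually independent -/
  iIndep_sign : iIndepFun (fun j x => Real.sign (x j)) D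

/-- `y` is an `ε`-corruption of `x`: the two families agree on at least a `(1 - ε)`-fraction of
the indices, and `y` is arbitrary on the others. -/
def IsCorruption {d n : ℕ} (ε : ℝ) (x y : Fin n → EuclideanSpace ℝ (Fin d)) : Prop :=
  (1 - ε) * (n : ℝ) ≤ (Set.ncard {i | y i = x i} : ℝ)

/-- The weights `w` with `0 ≤ w ≤ 1/n` entrywise and `‖w - (1/n) 𝟙‖₁ ≤ ε`. -/
def weights (n : ℕ) (ε : ℝ) : Set (Fin n → ℝ) :=
  {w | (∀ i, 0 ≤ w i ∧ w i ≤ 1 / (n : ℝ)) ∧ ∑ i, |w i - 1 / (n : ℝ)| ≤ ε}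

/-- The Huber loss on `ℝ` with parameter `h`. -/
def huber (h t : ℝ) : ℝ :=
  if |t| ≤ h then t ^ 2 / 2 else h * (|t| - h / 2)

/-- The derivative of the Huber loss. -/
def huberDeriv (h t : ℝ) : ℝ :=
  if |t| ≤ h then t else h * Real.sign t

/-- The entrywise Huber loss on `ℝ^d`. -/
def huberLoss {d : ℕ} (h : ℝ) (x : EuclideanSpace ℝ (Fin d)) : ℝ :=
  ∑ j, huber h (x j)

/-- The gradient of the entrywise Huber loss. -/
def huberGrad {d : ℕ} (h : ℝ) (x : EuclideanSpace ℝ (Fin d)) : EuclideanSpace ℝ (Fin d) :=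
  WithLp.toLp 2 (fun j => huberDeriv h (x j))

/-- The weighted empirical loss at the candidate location `μ`. -/
def weightedLoss {d n : ℕ} (h : ℝ) (y : Fin n → EuclideanSpace ℝ (Fin d)) (w : Fin n → ℝ)
    (μ : EuclideanSpace ℝ (Fin d)) : ℝ :=
  ∑ i, w i * huberLoss h (μ - y i)

/-- `μ` is a global minimizer of the weighted empirical loss. -/
def IsMinimizer {d n : ℕ} (h : ℝ) (y : Fin n → EuclideanSpace ℝ (Fin d)) (w : Fin n → ℝ)
    (μ : EuclideanSpace ℝ (Fin d)) : Prop :=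
  ∀ ν, weightedLoss h y w μ ≤ weightedLoss h y w ν

/-- The weighted empirical second-moment matrix of the clipped residuals at `μ`. -/
def clippedCov {d n : ℕ} (h : ℝ) (y : Fin n → EuclideanSpace ℝ (Fin d)) (w : Fin n → ℝ)
    (μ : EuclideanSpace ℝ (Fin d)) : Matrix (Fin d) (Fin d) ℝ :=
  Matrix.of fun j k => ∑ i, w i * (huberGrad h (y i - μ) j * huberGrad h (y i - μ) k)

/-- The population second-moment matrix of the clipped noise. -/
def noiseCov {d : ℕ} (h : ℝ) (D : Measure (EuclideanSpace ℝ (Fin d))) :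
    Matrix (Fin d) (Fin d) ℝ :=
  Matrix.of fun j k => ∫ x, huberGrad h x j * huberGrad h x k ∂D

/-- The spectral norm (Euclidean operator norm) of a square matrix. -/
def specNorm {d : ℕ} (A : Matrix (Fin d) (Fin d) ℝ) : ℝ :=
  ‖Matrix.toEuclideanCLM (n := Fin d) (𝕜 := ℝ) A‖

end

end HuberLocation

/-! Write `Δ = μhat - μstar`, `r = ‖Δ‖`, and let `f` be the clipped gradient. The first-order
condition says that the weighted sum of the `f (y i - μhat)` vanishes. Split `w = a + b`, with `a`
carried by uncorrupted points and `b` of mass at most `ε`, and pair the condition with `Δ`. The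
curvature `B = ∑ a i ⟪f (η i) - f (η i - Δ), Δ⟫` then equals `∑ a i ⟪f (η i), Δ⟫ + ∑ b i ⟪f (y i -
μhat), Δ⟫`.

Lower bound: a noise entry of size at most `1` stays in the linear range of `f` under a shift of
size at most `1`. Every coordinate has a fraction of about `α` of such entries, so `B` is at least
about `α r²`; `IsRegular.abs_coord_le_one` first shows that all coordinates of `Δ` are at most `1`.

Upper bound: the clean sum is handled by concentration. By Cauchy–Schwarz the corrupted sum is at
most the root of `ε` times the second moment of the `b`-part along `Δ`. That moment is the full one,
which the spectral norm controls, minus the clean one. Shifting the clean points by `Δ` changes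
their second moment by `O(r² √B)`, because each increment lies in `[0, r²]` and so its square is at
most `r²` times itself. Hence `B` bounds itself (`IsRegular.curvature_bounds`), and
`le_of_self_bound` absorbs the `√B` term by AM–GM. This absorption produces the power `α ^ (-3/2)`.

Only deterministic properties of the sample are used (`IsRegular`), which makes the bound uniform in
the corruption and in `w`. They hold with high probability because, given the absolute values, the
projections of `f η` are sums of independent symmetric signs, hence sub-Gaussian. Chernoff bounds
and a union over a net of `25 ^ d` directions finish the argument
(`IsSemiProduct.measure_not_isRegular_le`). -/

namespace HuberLocation

/-! ### Nets and reduction to finitely many directions -/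

/-- A finite `1`-net of the ball of radius `2`, of cardinality at most `5 ^ dim E`. -/
lemma exists_net_radius_two (E : Type*) [NormedAddCommGroup E] [NormedSpace ℝ E]
    [FiniteDimensional ℝ E] :
    ∃ s : Finset E, s.card ≤ 5 ^ Module.finrank ℝ E ∧ (∀ c ∈ s, ‖c‖ ≤ 2) ∧
      ∀ x : E, ‖x‖ ≤ 2 → ∃ c ∈ s, ‖x - c‖ ≤ 1 := by
  classical
  let P : ℕ → Prop := fun k => ∃ s : Finset E, s.card = k ∧ (∀ c ∈ s, ‖c‖ ≤ 2) ∧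
    ∀ c ∈ s, ∀ d ∈ s, c ≠ d → 1 ≤ ‖c - d‖
  have h0 : P 0 := ⟨∅, by simp⟩
  -- A separated set of greatest cardinality is a net, since a point far from all of it could be
  -- added. The volumetric packing bound makes the search finite.
  have hspec : P (Nat.findGreatest P (5 ^ Module.finrank ℝ E)) :=
    Nat.findGreatest_spec (Nat.zero_le _) h0
  obtain ⟨s, hcard, hs, hsep⟩ := hspec
  refine ⟨s, Besicovitch.card_le_of_separated s hs hsep, hs, fun x hx => ?_⟩
  by_contra! hfar
  have hxs : x ∉ s := fun h => by have := hfar x h; simp at this; linarith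
  have hs' : ∀ c ∈ insert x s, ‖c‖ ≤ 2 := by
    intro c hc
    rcases Finset.mem_insert.1 hc with rfl | hc
    · exact hx
    · exact hs c hc
  have hsep' : ∀ c ∈ insert x s, ∀ d ∈ insert x s, c ≠ d → 1 ≤ ‖c - d‖ := by
    intro c hc d hd hcd
    rcases Finset.mem_insert.1 hc with rfl | hc <;> rcases Finset.mem_insert.1 hd with rfl | hd
    · exact absurd rfl hcd
    · exact (hfar d hd).le
    · rw [norm_sub_rev]; exact (hfar c (by assumption)).le
    · exact hsep c hc d hd hcd
  have hP : P (s.card + 1) := ⟨insert x s, by simp [hxs], hs', hsep'⟩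
  have hle : s.card + 1 ≤ 5 ^ Module.finrank ℝ E := by
    have := Besicovitch.card_le_of_separated _ hs' hsep'
    simpa [hxs] using this
  have := Nat.le_findGreatest hle hP
  omega

/-- A finite `1/4`-net of the unit ball. -/
lemma exists_quarter_net (E : Type*) [NormedAddCommGroup E] [NormedSpace ℝ E]
    [FiniteDimensional ℝ E] :
    ∃ s : Finset E, s.card ≤ 25 ^ Module.finrank ℝ E ∧ (∀ c ∈ s, ‖c‖ ≤ 3 / 2) ∧
      ∀ x : E, ‖x‖ ≤ 1 → ∃ c ∈ s, ‖x - c‖ ≤ 1 / 4 := by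
  classical
  obtain ⟨s, hcard, hs, hnet⟩ := exists_net_radius_two E
  -- Two rounds of approximation: `c` approximates `2x` within `1`, then `c'` approximates the
  -- doubled error within `1`. This leaves an error of `1/4`, and the net points have norm at most
  -- `2/2 + 2/4`.
  refine ⟨(s ×ˢ s).image (fun p => (1 / 2 : ℝ) • p.1 + (1 / 4 : ℝ) • p.2), ?_, ?_, ?_⟩
  · calc _ ≤ (s ×ˢ s).card := Finset.card_image_le
      _ = s.card * s.card := Finset.card_product _ _
      _ ≤ 5 ^ Module.finrank ℝ E * 5 ^ Module.finrank ℝ E := Nat.mul_le_mul hcard hcard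
      _ = 25 ^ Module.finrank ℝ E := by rw [← mul_pow]; norm_num
  · intro c hc
    obtain ⟨p, hp, rfl⟩ := Finset.mem_image.1 hc
    obtain ⟨h1, h2⟩ := Finset.mem_product.1 hp
    have h3 := norm_add_le ((1 / 2 : ℝ) • p.1) ((1 / 4 : ℝ) • p.2)
    rw [norm_smul, norm_smul, Real.norm_of_nonneg (by norm_num),
      Real.norm_of_nonneg (by norm_num)] at h3
    linarith [hs _ h1, hs _ h2]
  · intro x hx
    obtain ⟨c, hc, hxc⟩ := hnet ((2 : ℝ) • x) (by
      rw [norm_smul, Real.norm_of_nonneg (by norm_num)]; linarith)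
    obtain ⟨c', hc', hxc'⟩ := hnet ((2 : ℝ) • ((2 : ℝ) • x - c)) (by
      rw [norm_smul, Real.norm_of_nonneg (by norm_num)]; linarith)
    refine ⟨_, Finset.mem_image.2 ⟨(c, c'), Finset.mem_product.2 ⟨hc, hc'⟩, rfl⟩, ?_⟩
    have : x - ((1 / 2 : ℝ) • c + (1 / 4 : ℝ) • c')
        = (1 / 4 : ℝ) • ((2 : ℝ) • ((2 : ℝ) • x - c) - c') := by
      module
    rw [this, norm_smul, Real.norm_of_nonneg (by norm_num)]
    linarith

/-- A vector is bounded by its inner products with the points of a `1/4`-net. -/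
lemma inner_le_of_net {E : Type*} [NormedAddCommGroup E] [InnerProductSpace ℝ E]
    {s : Finset E} (hnet : ∀ x : E, ‖x‖ ≤ 1 → ∃ c ∈ s, ‖x - c‖ ≤ 1 / 4) {m : E} {a : ℝ}
    (h : ∀ c ∈ s, inner ℝ m c ≤ a) (u : E) :
    inner ℝ m u ≤ 4 / 3 * a * ‖u‖ := by
  have hm : ‖m‖ ≤ 4 / 3 * a := by
    rcases eq_or_ne m 0 with rfl | hm
    · obtain ⟨c, hc, -⟩ := hnet 0 (by simp)
      have := h c hc
      simp at this ⊢
      exact this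
    · have hpos : 0 < ‖m‖ := norm_pos_iff.2 hm
      obtain ⟨c, hc, hmc⟩ := hnet (‖m‖⁻¹ • m) (by
        rw [norm_smul, norm_inv, norm_norm, inv_mul_cancel₀ hpos.ne'])
      have h1 : inner ℝ m (‖m‖⁻¹ • m) = ‖m‖ := by
        rw [inner_smul_right, real_inner_self_eq_norm_sq]
        field_simp
      have h2 : inner ℝ m (‖m‖⁻¹ • m) = inner ℝ m c + inner ℝ m (‖m‖⁻¹ • m - c) := by
        rw [← inner_add_right]; simp
      have h3 := real_inner_le_norm m (‖m‖⁻¹ • m - c)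
      have h4 : ‖m‖ * ‖‖m‖⁻¹ • m - c‖ ≤ ‖m‖ * (1 / 4) := by gcongr
      linarith [h c hc]
  exact (real_inner_le_norm m u).trans (by gcongr)

/-- A quadratic form is bounded on the unit ball by its values on a `1/4`-net. The quadratic form
is described by continuity, homogeneity and a polarization identity. -/
lemma abs_quadratic_le_of_net {E : Type*} [NormedAddCommGroup E] [InnerProductSpace ℝ E]
    [FiniteDimensional ℝ E] {s : Finset E} (hs : ∀ c ∈ s, ‖c‖ ≤ 3 / 2)
    (hnet : ∀ x : E, ‖x‖ ≤ 1 → ∃ c ∈ s, ‖x - c‖ ≤ 1 / 4) {Q : E → ℝ} (hQ : Continuous Q)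
    (hsmul : ∀ (c : ℝ) u, Q (c • u) = c ^ 2 * Q u)
    (hpol : ∀ u v, Q u - Q v = 1 / 4 * (Q ((3 : ℝ) • (u - v) + (1 / 3 : ℝ) • (u + v))
      - Q ((3 : ℝ) • (u - v) - (1 / 3 : ℝ) • (u + v)))) {a : ℝ}
    (h : ∀ c ∈ s, |Q c| ≤ a) (u : E) : |Q u| ≤ 3 * a * ‖u‖ ^ 2 := by
  obtain ⟨x, hx, hmax⟩ := (isCompact_closedBall (0 : E) 1).exists_isMaxOn
    ⟨0, by simp⟩ (continuous_abs.comp hQ).continuousOn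
  have hx1 : ‖x‖ ≤ 1 := by simpa using hx
  set M := |Q x| with hM
  have hM0 : 0 ≤ M := abs_nonneg _
  have hball : ∀ y : E, |Q y| ≤ M * ‖y‖ ^ 2 := by
    intro y
    rcases eq_or_ne y 0 with rfl | hy
    · have := hsmul 0 (0 : E)
      simp at this
      simp [this]
    · have hpos : 0 < ‖y‖ := norm_pos_iff.2 hy
      have h1 : |Q (‖y‖⁻¹ • y)| ≤ M := hmax (by
        simp [norm_smul, inv_mul_cancel₀ hpos.ne'])
      rw [hsmul, abs_mul, abs_of_nonneg (by positivity)] at h1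
      have h2 := mul_le_mul_of_nonneg_right h1 (sq_nonneg ‖y‖)
      have h3 : ‖y‖⁻¹ ^ 2 * |Q y| * ‖y‖ ^ 2 = |Q y| := by field_simp
      rwa [h3] at h2
  obtain ⟨c, hc, hxc⟩ := hnet x hx1
  have hplus : ‖x + c‖ ≤ 5 / 2 := (norm_add_le _ _).trans (by linarith [hs c hc])
  -- The factors `3` and `1/3` balance the short vector `x - c` against the long `x + c`. The
  -- polarized difference then costs less than `2/3` of the maximum `M` and can be absorbed; without
  -- rescaling it would exceed `M`.
  set p := (3 : ℝ) • (x - c) + (1 / 3 : ℝ) • (x + c)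
  set q := (3 : ℝ) • (x - c) - (1 / 3 : ℝ) • (x + c)
  have hpq : ‖p‖ ^ 2 + ‖q‖ ^ 2 = 2 * (9 * ‖x - c‖ ^ 2 + ‖x + c‖ ^ 2 / 9) := by
    have := parallelogram_law_with_norm ℝ ((3 : ℝ) • (x - c)) ((1 / 3 : ℝ) • (x + c))
    rw [norm_smul, norm_smul, Real.norm_of_nonneg (by norm_num),
      Real.norm_of_nonneg (by norm_num)] at this
    simp only [p, q]
    nlinarith [this]
  have h1 : ‖x - c‖ ^ 2 ≤ 1 / 16 := by nlinarith [norm_nonneg (x - c)]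
  have h2 : ‖x + c‖ ^ 2 ≤ 25 / 4 := by nlinarith [norm_nonneg (x + c)]
  have h3 : |Q x| ≤ |Q c| + 1 / 4 * (|Q p| + |Q q|) := by
    have e : Q x = Q c + 1 / 4 * (Q p - Q q) := by linarith [hpol x c]
    rw [e]
    refine (abs_add_le _ _).trans ?_
    rw [abs_mul, abs_of_pos (by norm_num : (0 : ℝ) < 1 / 4)]
    gcongr
    exact abs_sub _ _
  have h4 : |Q p| + |Q q| ≤ M * (2 * (9 * (1 / 16) + 25 / 4 / 9)) := by
    calc |Q p| + |Q q| ≤ M * (‖p‖ ^ 2 + ‖q‖ ^ 2) := by linarith [hball p, hball q]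
      _ ≤ _ := by rw [hpq]; gcongr
  have h5 : M ≤ 3 * a := by linarith [h c hc]
  exact (hball u).trans (by gcongr)

/-! ### Chernoff bound and exponential moments -/

/-- The Chernoff bound for sums of independent copies of one random variable. -/
lemma measure_pi_sum_gt_le {Ω : Type*} [MeasurableSpace Ω] {D : Measure Ω}
    [IsProbabilityMeasure D] {g : Ω → ℝ} (hg : Measurable g) {a : ℝ}
    (h : ∫⁻ x, ENNReal.ofReal (Real.exp (g x)) ∂D ≤ ENNReal.ofReal (Real.exp a)) (n : ℕ) (t : ℝ) :
    Measure.pi (fun _ : Fin n => D) {η | n * a + t < ∑ i, g (η i)}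
      ≤ ENNReal.ofReal (Real.exp (-t)) := by
  have hprod : ∫⁻ η, ∏ i, ENNReal.ofReal (Real.exp (g (η i))) ∂(Measure.pi fun _ : Fin n => D)
      ≤ ENNReal.ofReal (Real.exp (n * a)) := by
    have hind : iIndepFun (fun (i : Fin n) (η : Fin n → Ω) => ENNReal.ofReal (Real.exp (g (η i))))
        (Measure.pi fun _ : Fin n => D) :=
      iIndepFun_pi (X := fun _ x => ENNReal.ofReal (Real.exp (g x)))
        (fun _ => by fun_prop)
    rw [lintegral_prod_eq_prod_lintegral_of_indepFun Finset.univ _ hind (fun i => by fun_prop)]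
    have hi : ∀ i : Fin n, ∫⁻ η, ENNReal.ofReal (Real.exp (g (η i)))
        ∂(Measure.pi fun _ : Fin n => D) ≤ ENNReal.ofReal (Real.exp a) := fun i => by
      rw [(measurePreserving_eval (fun _ : Fin n => D) i).lintegral_comp
        (f := fun x => ENNReal.ofReal (Real.exp (g x))) (by fun_prop)]
      exact h
    refine (Finset.prod_le_prod' fun i _ => hi i).trans ?_
    rw [Finset.prod_const, Finset.card_univ, Fintype.card_fin, Real.exp_nat_mul,
      ENNReal.ofReal_pow (Real.exp_nonneg _)]
  have hmarkov := mul_meas_ge_le_lintegral₀ (μ := Measure.pi fun _ : Fin n => D)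
    (f := fun η => ∏ i, ENNReal.ofReal (Real.exp (g (η i)))) (Measurable.aemeasurable (by fun_prop))
    (ENNReal.ofReal (Real.exp (n * a + t)))
  have hsub : {η : Fin n → Ω | n * a + t < ∑ i, g (η i)} ⊆
      {η | ENNReal.ofReal (Real.exp (n * a + t)) ≤ ∏ i, ENNReal.ofReal (Real.exp (g (η i)))} := by
    intro η hη
    simp only [Set.mem_ofPred_eq] at hη ⊢
    rw [← ENNReal.ofReal_prod_of_nonneg fun _ _ => Real.exp_nonneg _, ← Real.exp_sum]
    exact ENNReal.ofReal_le_ofReal (Real.exp_le_exp.2 hη.le)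
  have hpos : 0 < Real.exp (n * a + t) := Real.exp_pos _
  refine (measure_mono hsub).trans ?_
  rw [mul_comm] at hmarkov
  have hle := (ENNReal.le_div_iff_mul_le (Or.inl (ENNReal.ofReal_pos.2 hpos).ne')
    (Or.inl ENNReal.ofReal_ne_top)).2 (hmarkov.trans hprod)
  refine hle.trans ?_
  rw [← ENNReal.ofReal_div_of_pos hpos, ← Real.exp_sub]
  exact ENNReal.ofReal_le_ofReal (Real.exp_le_exp.2 (by linarith))

lemma lintegral_exp_neg_mul_sub_sq {b : ℝ} (hb : 0 < b) (c : ℝ) :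
    ∫⁻ x : ℝ, ENNReal.ofReal (Real.exp (-b * (x - c) ^ 2)) = ENNReal.ofReal √(Real.pi / b) := by
  rw [lintegral_sub_right_eq_self (fun x => ENNReal.ofReal (Real.exp (-b * x ^ 2))) c,
    ← ofReal_integral_eq_lintegral_ofReal (integrable_exp_neg_mul_sq hb)
      (ae_of_all _ fun _ => Real.exp_nonneg _), integral_gaussian]

/-- The square of a sub-Gaussian random variable has a finite exponential moment. -/
lemma lintegral_exp_sq_le_two {Ω : Type*} [MeasurableSpace Ω] {D : Measure Ω}
    [IsProbabilityMeasure D] {Z : Ω → ℝ} (hZ : Measurable Z) {σ : ℝ} (hσ : 0 < σ)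
    (h : ∀ t : ℝ, ∫⁻ x, ENNReal.ofReal (Real.exp (t * Z x)) ∂D
      ≤ ENNReal.ofReal (Real.exp (σ * t ^ 2))) :
    ∫⁻ x, ENNReal.ofReal (Real.exp (Z x ^ 2 / (8 * σ))) ∂D ≤ 2 := by
  have hb : 0 < 2 * σ := by positivity
  -- Completing the square writes `exp (z² / (8σ))` as a Gaussian average of `exp (t z)`. Tonelli
  -- then brings in the sub-Gaussian bound for each `t`, and the ratio of the two Gaussian integrals
  -- is `√2 ≤ 2`.
  have hrepr : ∀ z : ℝ, ENNReal.ofReal (Real.exp (z ^ 2 / (8 * σ))) *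
      ENNReal.ofReal √(Real.pi / (2 * σ)) =
      ∫⁻ t : ℝ, ENNReal.ofReal (Real.exp (-(2 * σ) * t ^ 2)) * ENNReal.ofReal (Real.exp (t * z)) := by
    intro z
    rw [← lintegral_exp_neg_mul_sub_sq hb (z / (4 * σ)), ← lintegral_const_mul _ (by fun_prop)]
    refine lintegral_congr fun t => ?_
    rw [← ENNReal.ofReal_mul (Real.exp_nonneg _), ← ENNReal.ofReal_mul (Real.exp_nonneg _),
      ← Real.exp_add, ← Real.exp_add]
    congr 2
    field_simp
    ring
  have key : (∫⁻ x, ENNReal.ofReal (Real.exp (Z x ^ 2 / (8 * σ))) ∂D) *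
      ENNReal.ofReal √(Real.pi / (2 * σ)) ≤ ENNReal.ofReal √(Real.pi / σ) := by
    rw [← lintegral_mul_const _ (by fun_prop)]
    simp_rw [hrepr]
    rw [lintegral_lintegral_swap (by fun_prop)]
    calc _ ≤ ∫⁻ t : ℝ, ENNReal.ofReal (Real.exp (-σ * (t - 0) ^ 2)) := by
          refine lintegral_mono fun t => ?_
          rw [lintegral_const_mul _ (by fun_prop)]
          refine (mul_le_mul_right (h t) _).trans ?_
          rw [← ENNReal.ofReal_mul (Real.exp_nonneg _), ← Real.exp_add]
          refine ENNReal.ofReal_le_ofReal (Real.exp_le_exp.2 (le_of_eq ?_))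
          ring
      _ = _ := lintegral_exp_neg_mul_sub_sq hσ 0
  have hpos : 0 < √(Real.pi / (2 * σ)) := Real.sqrt_pos.2 (by positivity)
  have hle := (ENNReal.le_div_iff_mul_le (Or.inl (ENNReal.ofReal_pos.2 hpos).ne')
    (Or.inl ENNReal.ofReal_ne_top)).2 key
  refine hle.trans ?_
  rw [← ENNReal.ofReal_div_of_pos hpos, ← Real.sqrt_div (by positivity)]
  have : Real.pi / σ / (Real.pi / (2 * σ)) = 2 := by field_simp
  rw [this]
  refine ENNReal.ofReal_le_of_le_toReal ?_
  rw [ENNReal.toReal_ofNat, Real.sqrt_le_left (by norm_num)]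
  norm_num

/-- Bernstein-type bound for the moment generating function of a nonnegative random variable with
an exponential moment. -/
lemma lintegral_exp_mul_sub_integral_le {Ω : Type*} [MeasurableSpace Ω] {D : Measure Ω}
    [IsProbabilityMeasure D] {W : Ω → ℝ} (hW : Measurable W) (hW0 : ∀ x, 0 ≤ W x)
    (h : ∫⁻ x, ENNReal.ofReal (Real.exp (W x)) ∂D ≤ 2) {t : ℝ} (ht : |t| ≤ 1 / 2) :
    ∫⁻ x, ENNReal.ofReal (Real.exp (t * (W x - ∫ y, W y ∂D))) ∂D
      ≤ ENNReal.ofReal (Real.exp (16 * t ^ 2)) := by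
  have hexp : Integrable (fun x => Real.exp (W x)) D :=
    ⟨by fun_prop, (hasFiniteIntegral_iff_ofReal (ae_of_all _ fun _ => Real.exp_nonneg _)).2
      (h.trans_lt ENNReal.ofNat_lt_top)⟩
  have hWint : Integrable W D := by
    refine hexp.mono' (by fun_prop) (ae_of_all _ fun x => ?_)
    rw [Real.norm_of_nonneg (hW0 x)]
    linarith [Real.add_one_le_exp (W x)]
  have hexp2 : ∫ x, Real.exp (W x) ∂D ≤ 2 := by
    rw [integral_eq_lintegral_of_nonneg_ae (ae_of_all _ fun _ => Real.exp_nonneg _) (by fun_prop)]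
    exact ENNReal.toReal_le_of_le_ofReal (by norm_num) (by simpa using h)
  set m := ∫ y, W y ∂D with hm
  -- The Taylor remainder is at most `(t w)² exp |t w|`; here `|t w| ≤ w / 2`, and `w² ≤ 8 exp (w /
  -- 2)` supplies the other half of the exponent.
  have hpt : ∀ w : ℝ, 0 ≤ w → Real.exp (t * w) ≤ 1 + t * w + 8 * t ^ 2 * Real.exp w := by
    intro w hw
    have h1 : |Real.exp (t * w) - (1 + t * w)| ≤ |t * w| ^ 2 * Real.exp |t * w| := by
      have := Complex.norm_exp_sub_sum_le_norm_mul_exp ((t * w : ℝ) : ℂ) 2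
      simp only [Finset.sum_range_succ, Finset.sum_range_zero, Nat.factorial] at this
      rw [Complex.norm_real, Real.norm_eq_abs] at this
      convert this using 1
      rw [← Real.norm_eq_abs, ← Complex.norm_real]
      congr 1
      push_cast
      simp
    have h2 : |t * w| ≤ w / 2 := by
      rw [abs_mul, abs_of_nonneg hw]
      nlinarith
    have h3 : w ^ 2 ≤ 8 * Real.exp (w / 2) := by
      have := Real.quadratic_le_exp_of_nonneg (x := w / 2) (by positivity)
      nlinarith
    have h4 : |t * w| ^ 2 * Real.exp |t * w| ≤ 8 * t ^ 2 * Real.exp w := by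
      calc |t * w| ^ 2 * Real.exp |t * w| ≤ (t ^ 2 * w ^ 2) * Real.exp (w / 2) := by
            rw [sq_abs, mul_pow]; gcongr
        _ ≤ (t ^ 2 * (8 * Real.exp (w / 2))) * Real.exp (w / 2) := by gcongr
        _ = 8 * t ^ 2 * (Real.exp (w / 2) * Real.exp (w / 2)) := by ring
        _ = _ := by rw [← Real.exp_add]; ring_nf
    linarith [le_abs_self (Real.exp (t * w) - (1 + t * w))]
  have hint : Integrable (fun x => (1 + t * W x + 8 * t ^ 2 * Real.exp (W x)) *
      Real.exp (-(t * m))) D :=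
    (((integrable_const _).add (hWint.const_mul _)).add (hexp.const_mul _)).mul_const _
  have hle : ∀ x, Real.exp (t * (W x - m)) ≤
      (1 + t * W x + 8 * t ^ 2 * Real.exp (W x)) * Real.exp (-(t * m)) := by
    intro x
    rw [mul_sub, sub_eq_add_neg, Real.exp_add]
    gcongr
    exact hpt _ (hW0 x)
  have hnn : ∀ x, 0 ≤ (1 + t * W x + 8 * t ^ 2 * Real.exp (W x)) * Real.exp (-(t * m)) :=
    fun x => (Real.exp_nonneg _).trans (hle x)
  refine (lintegral_mono fun x => ENNReal.ofReal_le_ofReal (hle x)).trans ?_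
  rw [← ofReal_integral_eq_lintegral_ofReal hint (ae_of_all _ hnn)]
  refine ENNReal.ofReal_le_ofReal ?_
  have hlin : Integrable (fun x => 1 + t * W x) D := (integrable_const _).add (hWint.const_mul _)
  rw [integral_mul_const, integral_add hlin (hexp.const_mul _), integral_add (integrable_const _) (hWint.const_mul _),
    integral_const_mul, integral_const_mul, ← hm]
  simp only [integral_const, probReal_univ, one_smul]
  calc _ ≤ (t * m + 16 * t ^ 2 + 1) * Real.exp (-(t * m)) := by
        refine mul_le_mul_of_nonneg_right ?_ (Real.exp_nonneg _)
        nlinarith [sq_nonneg t]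
    _ ≤ Real.exp (t * m + 16 * t ^ 2) * Real.exp (-(t * m)) := by
        gcongr
        exact Real.add_one_le_exp _
    _ = _ := by rw [← Real.exp_add]; ring_nf

/-- Pointwise, `exp (max (W - l) 0) ≤ 1 + exp (W - l)`. With `l = log (1/ε)` the total excess over
`l` is of order `n ε` up to deviations, which is what makes second moments stable under deleting few
samples. -/
lemma lintegral_exp_max_sub_le {Ω : Type*} [MeasurableSpace Ω] {D : Measure Ω}
    [IsProbabilityMeasure D] {W : Ω → ℝ} (hW : Measurable W)
    (h : ∫⁻ x, ENNReal.ofReal (Real.exp (W x)) ∂D ≤ 2) (l : ℝ) :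
    ∫⁻ x, ENNReal.ofReal (Real.exp (max (W x - l) 0)) ∂D
      ≤ ENNReal.ofReal (Real.exp (2 * Real.exp (-l))) := by
  have hle : ∀ x, ENNReal.ofReal (Real.exp (max (W x - l) 0)) ≤
      1 + ENNReal.ofReal (Real.exp (W x)) * ENNReal.ofReal (Real.exp (-l)) := by
    intro x
    rw [← ENNReal.ofReal_mul (Real.exp_nonneg _), ← Real.exp_add, ← ENNReal.ofReal_one,
      ← ENNReal.ofReal_add zero_le_one (Real.exp_nonneg _)]
    refine ENNReal.ofReal_le_ofReal ?_
    rcases max_cases (W x - l) 0 with ⟨h1, -⟩ | ⟨h1, -⟩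
    · rw [h1, sub_eq_add_neg]; linarith
    · rw [h1, Real.exp_zero]; linarith [Real.exp_pos (W x + -l)]
  refine (lintegral_mono hle).trans ?_
  rw [lintegral_add_left (by fun_prop), lintegral_mul_const _ (by fun_prop)]
  simp only [lintegral_const, measure_univ, mul_one]
  calc _ ≤ 1 + 2 * ENNReal.ofReal (Real.exp (-l)) := by gcongr
    _ = ENNReal.ofReal (2 * Real.exp (-l) + 1) := by
        rw [ENNReal.ofReal_add (by positivity) zero_le_one, ENNReal.ofReal_mul (by norm_num)]
        simp [add_comm]
    _ ≤ _ := ENNReal.ofReal_le_ofReal (Real.add_one_le_exp _)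

/-- Lower-tail estimate for the number of samples in `A`, from `exp (-t) ≤ 1 - t + t²` on `[0, 1]`.
-/
lemma lintegral_exp_neg_indicator_le {Ω : Type*} [MeasurableSpace Ω] {D : Measure Ω}
    [IsProbabilityMeasure D] {A : Set Ω} (hA : MeasurableSet A) {t : ℝ} (ht0 : 0 ≤ t)
    (ht1 : t ≤ 1) :
    ∫⁻ x, ENNReal.ofReal (Real.exp (-(t * A.indicator 1 x))) ∂D
      ≤ ENNReal.ofReal (Real.exp (-(t * D.real A) + t ^ 2)) := by
  have hle : ∀ x, Real.exp (-(t * A.indicator 1 x)) ≤ 1 + t ^ 2 - t * A.indicator 1 x := by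
    intro x
    by_cases hx : x ∈ A
    · simp only [hx, Set.indicator_of_mem, Pi.one_apply, mul_one]
      have := Real.abs_exp_sub_one_sub_id_le (x := -t) (by rw [abs_neg, abs_of_nonneg ht0]; exact ht1)
      have := (abs_le.1 this).2
      nlinarith
    · simp [hx, sq_nonneg]
  have hind : Integrable (A.indicator (1 : Ω → ℝ)) D := (integrable_const (1 : ℝ)).indicator hA
  have hint : Integrable (fun x => 1 + t ^ 2 - t * A.indicator (1 : Ω → ℝ) x) D :=
    (integrable_const _).sub (hind.const_mul _)
  refine (lintegral_mono fun x => ENNReal.ofReal_le_ofReal (hle x)).trans ?_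
  rw [← ofReal_integral_eq_lintegral_ofReal hint
    (ae_of_all _ fun x => (Real.exp_nonneg _).trans (hle x))]
  refine ENNReal.ofReal_le_ofReal ?_
  rw [integral_sub (integrable_const _) (hind.const_mul _), integral_const_mul,
    integral_indicator_one hA]
  simp only [integral_const, probReal_univ, one_smul]
  linarith [Real.add_one_le_exp (-(t * D.real A) + t ^ 2)]

/-! ### Sub-Gaussian projections of the clipped noise -/

lemma measurable_real_sign : Measurable Real.sign := by
  unfold Real.sign
  exact Measurable.ite measurableSet_Iio measurable_const
    (Measurable.ite measurableSet_Ioi measurable_const measurable_const)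

lemma abs_real_sign_le_one (t : ℝ) : |Real.sign t| ≤ 1 := by
  rcases Real.sign_apply_eq t with h | h | h <;> simp [h]

/-- Separates sign from magnitude, the form in which the semi-product structure can be used. -/
lemma huberDeriv_two_eq_sign_mul (t : ℝ) :
    huberDeriv 2 t = Real.sign t * min |t| 2 := by
  unfold huberDeriv
  split_ifs with h
  · rw [min_eq_left h]
    rcases lt_trichotomy t 0 with ht | rfl | ht
    · rw [Real.sign_of_neg ht, abs_of_neg ht]; ring
    · simp
    · rw [Real.sign_of_pos ht, abs_of_pos ht, one_mul]
  · rw [min_eq_right (not_le.1 h).le, mul_comm]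

lemma measurable_coord {d : ℕ} (j : Fin d) :
    Measurable fun x : EuclideanSpace ℝ (Fin d) => x j :=
  (EuclideanSpace.proj (𝕜 := ℝ) j).continuous.measurable

lemma measurable_huberDeriv_two : Measurable (huberDeriv 2) := by
  have : huberDeriv 2 = fun t => Real.sign t * min |t| 2 := funext huberDeriv_two_eq_sign_mul
  rw [this]
  exact measurable_real_sign.mul (by fun_prop)

lemma inner_huberGrad {d : ℕ} (x u : EuclideanSpace ℝ (Fin d)) :
    inner ℝ (huberGrad 2 x) u = ∑ j, huberDeriv 2 (x j) * u j := by
  simp [huberGrad, PiLp.inner_apply, mul_comm]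

lemma measurable_inner_huberGrad {d : ℕ} (u : EuclideanSpace ℝ (Fin d)) :
    Measurable fun x => inner ℝ (huberGrad 2 x) u := by
  simp_rw [inner_huberGrad]
  exact Finset.measurable_sum _ fun j _ =>
    (measurable_huberDeriv_two.comp (measurable_coord j)).mul_const _

/-- The sign of a symmetric coordinate is sub-Gaussian. -/
lemma lintegral_exp_mul_sign_le {d : ℕ} {D : Measure (EuclideanSpace ℝ (Fin d))}
    [IsProbabilityMeasure D] (j : Fin d)
    (hsymm : D.map (fun x => -x j) = D.map (fun x => x j)) (c : ℝ) :
    ∫⁻ x, ENNReal.ofReal (Real.exp (c * Real.sign (x j))) ∂D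
      ≤ ENNReal.ofReal (Real.exp (c ^ 2 / 2)) := by
  have hφ : Measurable fun t : ℝ => ENNReal.ofReal (Real.exp (c * Real.sign t)) := by
    have := measurable_real_sign; fun_prop
  have hj := measurable_coord j
  have hs := measurable_real_sign
  have h1 : ∫⁻ x, ENNReal.ofReal (Real.exp (c * Real.sign (x j))) ∂D =
      ∫⁻ x, ENNReal.ofReal (Real.exp (-(c * Real.sign (x j)))) ∂D := by
    calc _ = ∫⁻ t, ENNReal.ofReal (Real.exp (c * Real.sign t)) ∂(D.map fun x => x j) :=
          (lintegral_map hφ hj).symm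
      _ = ∫⁻ t, ENNReal.ofReal (Real.exp (c * Real.sign t)) ∂(D.map fun x => -x j) := by
          rw [hsymm]
      _ = ∫⁻ x, ENNReal.ofReal (Real.exp (c * Real.sign (-x j))) ∂D :=
          lintegral_map hφ hj.neg
      _ = _ := by simp_rw [Real.sign_neg, mul_neg]
  -- By symmetry the moments at `c` and `-c` agree, so twice the moment is the mean of `2 cosh`. An
  -- atom at `0` is harmless, because only `sign² ≤ 1` is used.
  have h2 : 2 * ∫⁻ x, ENNReal.ofReal (Real.exp (c * Real.sign (x j))) ∂D ≤
      2 * ENNReal.ofReal (Real.exp (c ^ 2 / 2)) := by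
    calc _ = ∫⁻ x, (ENNReal.ofReal (Real.exp (c * Real.sign (x j))) +
            ENNReal.ofReal (Real.exp (-(c * Real.sign (x j))))) ∂D := by
          rw [lintegral_add_left (by fun_prop), ← h1, two_mul]
      _ ≤ ∫⁻ _, 2 * ENNReal.ofReal (Real.exp (c ^ 2 / 2)) ∂D := by
          refine lintegral_mono fun x => ?_
          have h2 : 2 * ENNReal.ofReal (Real.exp (c ^ 2 / 2)) =
              ENNReal.ofReal (2 * Real.exp (c ^ 2 / 2)) := by
            rw [ENNReal.ofReal_mul (by norm_num), ENNReal.ofReal_ofNat]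
          rw [← ENNReal.ofReal_add (Real.exp_nonneg _) (Real.exp_nonneg _), h2]
          refine ENNReal.ofReal_le_ofReal ?_
          have h3 := Real.cosh_le_exp_half_sq (c * Real.sign (x j))
          rw [Real.cosh_eq] at h3
          have h4 : Real.exp ((c * Real.sign (x j)) ^ 2 / 2) ≤ Real.exp (c ^ 2 / 2) := by
            refine Real.exp_le_exp.2 ?_
            have h5 : Real.sign (x j) ^ 2 ≤ 1 := (sq_le_one_iff_abs_le_one _).2
              (abs_real_sign_le_one _)
            rw [mul_pow]
            nlinarith [sq_nonneg c]
          linarith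
      _ = _ := by simp
  exact (ENNReal.mul_le_mul_iff_right (by norm_num) (by norm_num)).1 h2

/-- The projections of the clipped noise are sub-Gaussian. -/
lemma IsSemiProduct.lintegral_exp_inner_le {d : ℕ} {α ρ : ℝ}
    {D : Measure (EuclideanSpace ℝ (Fin d))} [IsProbabilityMeasure D] (hD : IsSemiProduct α ρ D)
    (u : EuclideanSpace ℝ (Fin d)) (t : ℝ) :
    ∫⁻ x, ENNReal.ofReal (Real.exp (t * inner ℝ (huberGrad 2 x) u)) ∂D
      ≤ ENNReal.ofReal (Real.exp (2 * ‖u‖ ^ 2 * t ^ 2)) := by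
  have hs := measurable_real_sign
  have hc := fun j : Fin d => measurable_coord j
  let S : EuclideanSpace ℝ (Fin d) → Fin d → ℝ := fun x j => Real.sign (x j)
  let A : EuclideanSpace ℝ (Fin d) → Fin d → ℝ := fun x j => |x j|
  have hS : Measurable S := by fun_prop
  have hA : Measurable A := by fun_prop
  let F : (Fin d → ℝ) × (Fin d → ℝ) → ENNReal := fun p =>
    ∏ j, ENNReal.ofReal (Real.exp (t * u j * min (p.2 j) 2 * p.1 j))
  have hF : Measurable F := by fun_prop
  have hmap : D.map (fun x => (S x, A x)) = (D.map S).prod (D.map A) :=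
    (indepFun_iff_map_prod_eq_prod_map_map hS.aemeasurable hA.aemeasurable).1 hD.indep_sign_abs
  have hSprob : IsProbabilityMeasure (D.map S) := Measure.isProbabilityMeasure_map hS.aemeasurable
  have hAprob : IsProbabilityMeasure (D.map A) := Measure.isProbabilityMeasure_map hA.aemeasurable
  have hfac : ∀ x, ENNReal.ofReal (Real.exp (t * inner ℝ (huberGrad 2 x) u)) = F (S x, A x) := by
    intro x
    simp only [F, S, A]
    rw [← ENNReal.ofReal_prod_of_nonneg fun _ _ => Real.exp_nonneg _, ← Real.exp_sum,
      inner_huberGrad, Finset.mul_sum]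
    congr 2
    refine Finset.sum_congr rfl fun j _ => ?_
    rw [huberDeriv_two_eq_sign_mul]
    ring
  -- With the magnitudes frozen at `a`, independence of the signs factorizes the moment. Magnitudes
  -- clipped at `2` give `(2 t u j)² / 2 = 2 t² (u j)²` per coordinate.
  have hinner : ∀ a : Fin d → ℝ, (∀ j, 0 ≤ a j) → ∫⁻ s, F (s, a) ∂(D.map S) ≤
      ENNReal.ofReal (Real.exp (2 * ‖u‖ ^ 2 * t ^ 2)) := by
    intro a ha
    rw [lintegral_map (by fun_prop) hS]
    simp only [F, S]
    have hind : iIndepFun (fun (j : Fin d) (x : EuclideanSpace ℝ (Fin d)) =>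
        ENNReal.ofReal (Real.exp (t * u j * min (a j) 2 * Real.sign (x j)))) D :=
      hD.iIndep_sign.comp (fun j s => ENNReal.ofReal (Real.exp (t * u j * min (a j) 2 * s)))
        (fun j => by fun_prop)
    rw [lintegral_prod_eq_prod_lintegral_of_indepFun Finset.univ _ hind (fun j => by fun_prop)]
    refine (Finset.prod_le_prod' fun j _ => lintegral_exp_mul_sign_le j (hD.symm j) _).trans ?_
    rw [← ENNReal.ofReal_prod_of_nonneg fun _ _ => Real.exp_nonneg _, ← Real.exp_sum]
    refine ENNReal.ofReal_le_ofReal (Real.exp_le_exp.2 ?_)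
    rw [EuclideanSpace.real_norm_sq_eq, Finset.mul_sum, Finset.sum_mul]
    refine Finset.sum_le_sum fun j _ => ?_
    have h1 : min (a j) 2 ^ 2 ≤ 2 ^ 2 :=
      pow_le_pow_left₀ (le_min (ha j) (by norm_num)) (min_le_right _ _) 2
    have h2 : 0 ≤ t ^ 2 * u j ^ 2 := by positivity
    nlinarith
  simp_rw [hfac]
  calc ∫⁻ x, F (S x, A x) ∂D = ∫⁻ p, F p ∂(D.map fun x => (S x, A x)) :=
        (lintegral_map hF (by fun_prop)).symm
    _ = ∫⁻ a, ∫⁻ s, F (s, a) ∂(D.map S) ∂(D.map A) := by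
        rw [hmap, lintegral_prod_symm' _ hF]
    _ = ∫⁻ x, ∫⁻ s, F (s, A x) ∂(D.map S) ∂D := by
        rw [lintegral_map _ hA]
        exact hF.lintegral_prod_left'
    _ ≤ ∫⁻ _, ENNReal.ofReal (Real.exp (2 * ‖u‖ ^ 2 * t ^ 2)) ∂D :=
        lintegral_mono fun x => hinner _ fun j => abs_nonneg _
    _ = _ := by simp

lemma abs_huberDeriv_two_le (t : ℝ) : |huberDeriv 2 t| ≤ 2 := by
  rw [huberDeriv_two_eq_sign_mul, abs_mul, abs_of_nonneg (a := min |t| 2) (by positivity)]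
  calc _ ≤ 1 * (2 : ℝ) := mul_le_mul (abs_real_sign_le_one t) (min_le_right _ _) (by positivity)
        zero_le_one
    _ = 2 := one_mul 2

lemma abs_inner_huberGrad_le {d : ℕ} (u x : EuclideanSpace ℝ (Fin d)) :
    |inner ℝ (huberGrad 2 x) u| ≤ ∑ j, 2 * |u j| := by
  rw [inner_huberGrad]
  refine (Finset.abs_sum_le_sum_abs _ _).trans (Finset.sum_le_sum fun j _ => ?_)
  rw [abs_mul]
  gcongr
  exact abs_huberDeriv_two_le _

lemma integrable_inner_huberGrad_sq {d : ℕ} (D : Measure (EuclideanSpace ℝ (Fin d)))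
    [IsProbabilityMeasure D] (u : EuclideanSpace ℝ (Fin d)) :
    Integrable (fun x => inner ℝ (huberGrad 2 x) u ^ 2) D := by
  refine Integrable.of_bound ((measurable_inner_huberGrad u).pow_const 2).aestronglyMeasurable
    ((∑ j, 2 * |u j|) ^ 2) (ae_of_all _ fun x => ?_)
  rw [Real.norm_eq_abs, abs_pow]
  gcongr
  exact abs_inner_huberGrad_le u x

lemma integrable_huberGrad_mul {d : ℕ} (D : Measure (EuclideanSpace ℝ (Fin d)))
    [IsProbabilityMeasure D] (j k : Fin d) :
    Integrable (fun x => huberGrad 2 x j * huberGrad 2 x k) D := by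
  have hm : ∀ j : Fin d, Measurable fun x : EuclideanSpace ℝ (Fin d) => huberGrad 2 x j :=
    fun j => measurable_huberDeriv_two.comp (measurable_coord j)
  refine Integrable.of_bound ((hm j).mul (hm k)).aestronglyMeasurable (2 * 2)
    (ae_of_all _ fun x => ?_)
  rw [Real.norm_eq_abs, abs_mul]
  exact mul_le_mul (abs_huberDeriv_two_le _) (abs_huberDeriv_two_le _) (abs_nonneg _) (by norm_num)

/-- The second moment of a projection of the clipped noise as a quadratic form in the
direction. -/
lemma integral_inner_huberGrad_sq {d : ℕ} (D : Measure (EuclideanSpace ℝ (Fin d)))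
    [IsProbabilityMeasure D] (u : EuclideanSpace ℝ (Fin d)) :
    ∫ x, inner ℝ (huberGrad 2 x) u ^ 2 ∂D = ∑ j, ∑ k, noiseCov 2 D j k * (u j * u k) := by
  have h : ∀ x : EuclideanSpace ℝ (Fin d), inner ℝ (huberGrad 2 x) u ^ 2 =
      ∑ j, ∑ k, huberGrad 2 x j * huberGrad 2 x k * (u j * u k) := by
    intro x
    rw [inner_huberGrad, sq, Finset.sum_mul_sum]
    refine Finset.sum_congr rfl fun j _ => Finset.sum_congr rfl fun k _ => ?_
    simp only [huberGrad]
    ring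
  simp_rw [h]
  rw [integral_finsetSum _ fun j _ => integrable_finsetSum _ fun k _ =>
    (integrable_huberGrad_mul D j k).mul_const _]
  refine Finset.sum_congr rfl fun j _ => ?_
  rw [integral_finsetSum _ fun k _ => (integrable_huberGrad_mul D j k).mul_const _]
  refine Finset.sum_congr rfl fun k _ => ?_
  rw [integral_mul_const]
  rfl

lemma IsSemiProduct.lintegral_exp_inner_sq_le {d : ℕ} {α ρ : ℝ}
    {D : Measure (EuclideanSpace ℝ (Fin d))} [IsProbabilityMeasure D] (hD : IsSemiProduct α ρ D)
    {u : EuclideanSpace ℝ (Fin d)} {r : ℝ} (hr : 0 < r) (hu : ‖u‖ ≤ r) :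
    ∫⁻ x, ENNReal.ofReal (Real.exp (inner ℝ (huberGrad 2 x) u ^ 2 / (16 * r ^ 2))) ∂D ≤ 2 := by
  have h := lintegral_exp_sq_le_two (D := D) (measurable_inner_huberGrad u) (σ := 2 * r ^ 2)
    (by positivity) (fun t => (hD.lintegral_exp_inner_le u t).trans
      (ENNReal.ofReal_le_ofReal (Real.exp_le_exp.2 (by gcongr))))
  convert h using 6
  ring

/-- Follows from `z + 1 ≤ exp z` and the exponential moment of the square at `r = ‖u‖`. -/
lemma IsSemiProduct.integral_inner_sq_le {d : ℕ} {α ρ : ℝ}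
    {D : Measure (EuclideanSpace ℝ (Fin d))} [IsProbabilityMeasure D] (hD : IsSemiProduct α ρ D)
    (u : EuclideanSpace ℝ (Fin d)) :
    ∫ x, inner ℝ (huberGrad 2 x) u ^ 2 ∂D ≤ 16 * ‖u‖ ^ 2 := by
  rcases eq_or_ne u 0 with rfl | hu
  · simp
  have hr : 0 < ‖u‖ := norm_pos_iff.2 hu
  have h := hD.lintegral_exp_inner_sq_le hr le_rfl
  have hm := measurable_inner_huberGrad u
  have hexp : Integrable
      (fun x => Real.exp (inner ℝ (huberGrad 2 x) u ^ 2 / (16 * ‖u‖ ^ 2))) D :=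
    ⟨Measurable.aestronglyMeasurable (by fun_prop),
      (hasFiniteIntegral_iff_ofReal (ae_of_all _ fun _ => Real.exp_nonneg _)).2
      (h.trans_lt ENNReal.ofNat_lt_top)⟩
  have hexp2 : ∫ x, Real.exp (inner ℝ (huberGrad 2 x) u ^ 2 / (16 * ‖u‖ ^ 2)) ∂D ≤ 2 := by
    rw [integral_eq_lintegral_of_nonneg_ae (ae_of_all _ fun _ => Real.exp_nonneg _)
      hexp.aestronglyMeasurable]
    exact ENNReal.toReal_le_of_le_ofReal (by norm_num) (by simpa using h)
  have hle : ∫ x, (inner ℝ (huberGrad 2 x) u ^ 2 / (16 * ‖u‖ ^ 2) + 1) ∂D ≤ 2 :=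
    (integral_mono (((integrable_inner_huberGrad_sq D u).div_const _).add (integrable_const _)) hexp
      fun x => Real.add_one_le_exp _).trans hexp2
  rw [integral_add ((integrable_inner_huberGrad_sq D u).div_const _) (integrable_const _),
    integral_div] at hle
  simp only [integral_const, probReal_univ, one_smul] at hle
  have h1 : (∫ x, inner ℝ (huberGrad 2 x) u ^ 2 ∂D) / (16 * ‖u‖ ^ 2) ≤ 1 := by linarith
  rwa [div_le_one (by positivity)] at h1

/-! ### Regular samples and their probability -/

/-- The properties of a noise sample on which the error bound rests: concentration of the first
and second moments of the clipped noise, stability of the second moment under the removal of few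
samples, and enough small entries in every coordinate. -/
structure IsRegular {d n : ℕ} (D : Measure (EuclideanSpace ℝ (Fin d))) (α ε τ : ℝ)
    (η : Fin n → EuclideanSpace ℝ (Fin d)) : Prop where
  sum_le : ∀ u, ∑ i, inner ℝ (huberGrad 2 (η i)) u ≤ n * (8 * τ * ‖u‖)
  sq_dev : ∀ u, |(∑ i, inner ℝ (huberGrad 2 (η i)) u ^ 2) / n
    - ∫ x, inner ℝ (huberGrad 2 x) u ^ 2 ∂D| ≤ 2000 * τ * ‖u‖ ^ 2
  stable : ∀ v : Fin n → ℝ, (∀ i, 0 ≤ v i ∧ v i ≤ 1 / n) → ∑ i, v i ≤ 2 * ε →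
    ∀ u, ∑ i, v i * inner ℝ (huberGrad 2 (η i)) u ^ 2
      ≤ 432 * (ε * Real.log (1 / ε) + τ ^ 2) * ‖u‖ ^ 2
  small : ∀ j, n * (α - 2 * τ) ≤ ∑ i, {x : EuclideanSpace ℝ (Fin d) | |x j| ≤ 1}.indicator 1 (η i)

section Net

variable {d n : ℕ} {D : Measure (EuclideanSpace ℝ (Fin d))} {ε τ : ℝ}
  {η : Fin n → EuclideanSpace ℝ (Fin d)} {s : Finset (EuclideanSpace ℝ (Fin d))}

lemma sum_inner_le_of_net
    (hnet : ∀ x : EuclideanSpace ℝ (Fin d), ‖x‖ ≤ 1 → ∃ c ∈ s, ‖x - c‖ ≤ 1 / 4)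
    (h : ∀ c ∈ s, ∑ i, inner ℝ (huberGrad 2 (η i)) c ≤ n * (6 * τ))
    (u : EuclideanSpace ℝ (Fin d)) :
    ∑ i, inner ℝ (huberGrad 2 (η i)) u ≤ n * (8 * τ * ‖u‖) := by
  have := inner_le_of_net (m := ∑ i, huberGrad 2 (η i)) (a := n * (6 * τ)) hnet
    (fun c hc => by rw [sum_inner]; exact h c hc) u
  rw [sum_inner] at this
  linarith

lemma sq_dev_le_of_net [IsProbabilityMeasure D] (hs : ∀ c ∈ s, ‖c‖ ≤ 3 / 2)
    (hnet : ∀ x : EuclideanSpace ℝ (Fin d), ‖x‖ ≤ 1 → ∃ c ∈ s, ‖x - c‖ ≤ 1 / 4)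
    (h : ∀ c ∈ s, |(∑ i, inner ℝ (huberGrad 2 (η i)) c ^ 2) / n
      - ∫ x, inner ℝ (huberGrad 2 x) c ^ 2 ∂D| ≤ 612 * τ) (hτ : 0 ≤ τ)
    (u : EuclideanSpace ℝ (Fin d)) :
    |(∑ i, inner ℝ (huberGrad 2 (η i)) u ^ 2) / n
      - ∫ x, inner ℝ (huberGrad 2 x) u ^ 2 ∂D| ≤ 2000 * τ * ‖u‖ ^ 2 := by
  refine (abs_quadratic_le_of_net (Q := fun u => (∑ i, inner ℝ (huberGrad 2 (η i)) u ^ 2) / n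
      - ∫ x, inner ℝ (huberGrad 2 x) u ^ 2 ∂D) hs hnet ?_ ?_ ?_ h u).trans ?_
  · simp_rw [integral_inner_huberGrad_sq]
    fun_prop
  · intro c u
    simp_rw [inner_smul_right, mul_pow]
    rw [integral_const_mul, ← Finset.mul_sum]
    ring
  · intro u v
    have hpt : ∀ x : EuclideanSpace ℝ (Fin d), inner ℝ x u ^ 2 - inner ℝ x v ^ 2 =
        1 / 4 * (inner ℝ x ((3 : ℝ) • (u - v) + (1 / 3 : ℝ) • (u + v)) ^ 2
          - inner ℝ x ((3 : ℝ) • (u - v) - (1 / 3 : ℝ) • (u + v)) ^ 2) := by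
      intro x
      simp only [inner_add_right, inner_sub_right, inner_smul_right]
      ring
    have hi := fun w => integrable_inner_huberGrad_sq D w
    have e1 : ∫ x, inner ℝ (huberGrad 2 x) u ^ 2 ∂D - ∫ x, inner ℝ (huberGrad 2 x) v ^ 2 ∂D =
        1 / 4 * (∫ x, inner ℝ (huberGrad 2 x) ((3 : ℝ) • (u - v) + (1 / 3 : ℝ) • (u + v)) ^ 2 ∂D
          - ∫ x, inner ℝ (huberGrad 2 x) ((3 : ℝ) • (u - v) - (1 / 3 : ℝ) • (u + v)) ^ 2 ∂D) := by
      rw [← integral_sub (hi _) (hi _), ← integral_sub (hi _) (hi _), ← integral_const_mul]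
      exact integral_congr_ae (ae_of_all _ fun x => hpt _)
    have e2 : ∑ i, inner ℝ (huberGrad 2 (η i)) u ^ 2 - ∑ i, inner ℝ (huberGrad 2 (η i)) v ^ 2 =
        1 / 4 * (∑ i, inner ℝ (huberGrad 2 (η i)) ((3 : ℝ) • (u - v) + (1 / 3 : ℝ) • (u + v)) ^ 2
          - ∑ i, inner ℝ (huberGrad 2 (η i)) ((3 : ℝ) • (u - v) - (1 / 3 : ℝ) • (u + v)) ^ 2) := by
      rw [← Finset.sum_sub_distrib, ← Finset.sum_sub_distrib, Finset.mul_sum]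
      exact Finset.sum_congr rfl fun i _ => hpt _
    linear_combination e2 / n - e1
  · refine mul_le_mul_of_nonneg_right ?_ (sq_nonneg _)
    linarith

lemma weighted_sq_le_of_net (hs : ∀ c ∈ s, ‖c‖ ≤ 3 / 2)
    (hnet : ∀ x : EuclideanSpace ℝ (Fin d), ‖x‖ ≤ 1 → ∃ c ∈ s, ‖x - c‖ ≤ 1 / 4)
    {v : Fin n → ℝ} (hv : ∀ i, 0 ≤ v i) {a : ℝ}
    (h : ∀ c ∈ s, ∑ i, v i * inner ℝ (huberGrad 2 (η i)) c ^ 2 ≤ a)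
    (u : EuclideanSpace ℝ (Fin d)) :
    ∑ i, v i * inner ℝ (huberGrad 2 (η i)) u ^ 2 ≤ 3 * a * ‖u‖ ^ 2 := by
  refine (le_abs_self _).trans (abs_quadratic_le_of_net
    (Q := fun u => ∑ i, v i * inner ℝ (huberGrad 2 (η i)) u ^ 2) hs hnet ?_ ?_ ?_ ?_ u)
  · fun_prop
  · intro c u
    simp_rw [inner_smul_right, mul_pow]
    rw [Finset.mul_sum]
    exact Finset.sum_congr rfl fun i _ => by ring
  · intro u v
    rw [← Finset.sum_sub_distrib, ← Finset.sum_sub_distrib, Finset.mul_sum]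
    refine Finset.sum_congr rfl fun i _ => ?_
    simp only [inner_add_right, inner_sub_right, inner_smul_right]
    ring
  · intro c hc
    rw [abs_of_nonneg (Finset.sum_nonneg fun i _ => mul_nonneg (hv i) (sq_nonneg _))]
    exact h c hc

/-- Weights of small total mass cannot pick up much of a sample with light upper tail. -/
lemma sum_mul_le_of_sum_max_le {W : Fin n → ℝ} {v : Fin n → ℝ} (hn : 0 < n)
    (hv : ∀ i, 0 ≤ v i ∧ v i ≤ 1 / n) (hsum : ∑ i, v i ≤ 2 * ε) {l b : ℝ} (hl : 0 ≤ l)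
    (h : ∑ i, max (W i - l) 0 ≤ n * b) : ∑ i, v i * W i ≤ 2 * ε * l + b := by
  have hn' : (0 : ℝ) < n := Nat.cast_pos.2 hn
  calc ∑ i, v i * W i ≤ ∑ i, (v i * l + 1 / n * max (W i - l) 0) := by
        refine Finset.sum_le_sum fun i _ => ?_
        have h1 : v i * (W i - l) ≤ v i * max (W i - l) 0 :=
          mul_le_mul_of_nonneg_left (le_max_left _ _) (hv i).1
        have h2 : v i * max (W i - l) 0 ≤ 1 / n * max (W i - l) 0 :=
          mul_le_mul_of_nonneg_right (hv i).2 (le_max_right _ _)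
        linarith
    _ = (∑ i, v i) * l + 1 / n * ∑ i, max (W i - l) 0 := by
        rw [Finset.sum_add_distrib, Finset.sum_mul, Finset.mul_sum]
    _ ≤ 2 * ε * l + 1 / n * (n * b) := by gcongr
    _ = _ := by field_simp

end Net

/-- A sample of the noise is regular with high probability. -/
lemma IsSemiProduct.measure_not_isRegular_le {d n : ℕ} {α ε τ δ : ℝ}
    {D : Measure (EuclideanSpace ℝ (Fin d))} [IsProbabilityMeasure D] (hD : IsSemiProduct α 1 D)
    (hn : 0 < n) (hε : 0 < ε) (hlog : 1 ≤ Real.log (1 / ε)) (hτ : 0 < τ) (hτ1 : τ ≤ 1 / 2)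
    (hδ : 5 * 25 ^ d * Real.exp (-(n * τ ^ 2)) ≤ δ) :
    Measure.pi (fun _ : Fin n => D) {η | ¬ IsRegular D α ε τ η} ≤ ENNReal.ofReal δ := by
  have hn' : (0 : ℝ) < n := Nat.cast_pos.2 hn
  obtain ⟨s, hcard, hs, hnet⟩ := exists_quarter_net (EuclideanSpace ℝ (Fin d))
  rw [finrank_euclideanSpace_fin] at hcard
  set P := Measure.pi (fun _ : Fin n => D)
  set p := ENNReal.ofReal (Real.exp (-(n * τ ^ 2))) with hp
  set l := Real.log (1 / ε) with hl
  have hexpl : Real.exp (-l) = ε := by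
    rw [hl, one_div, Real.log_inv, neg_neg, Real.exp_log hε]
  let Z : EuclideanSpace ℝ (Fin d) → EuclideanSpace ℝ (Fin d) → ℝ :=
    fun c x => inner ℝ (huberGrad 2 x) c
  -- The scale is `36 = 16 (3/2)²`, since net points have norm at most `3/2`.
  let W : EuclideanSpace ℝ (Fin d) → EuclideanSpace ℝ (Fin d) → ℝ := fun c x => Z c x ^ 2 / 36
  have hZ : ∀ c, Measurable (Z c) := measurable_inner_huberGrad
  have hWm : ∀ c, Measurable (W c) := fun c => ((hZ c).pow_const 2).div_const 36
  have hW0 : ∀ c x, 0 ≤ W c x := fun c x => by positivity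
  have hWexp : ∀ c ∈ s, ∫⁻ x, ENNReal.ofReal (Real.exp (W c x)) ∂D ≤ 2 := fun c hc => by
    have := hD.lintegral_exp_inner_sq_le (by norm_num) (hs c hc)
    norm_num at this
    exact this
  -- Bad events for a net direction: large mean, large second moment, small second moment, large
  -- excess of `W` over `l`. The tilt `τ` in the first three makes both the mean term and the
  -- deviation of order `n τ²`.
  let A : EuclideanSpace ℝ (Fin d) → Fin 4 → Set (Fin n → EuclideanSpace ℝ (Fin d)) := fun c =>
    ![{η | n * (9 / 2 * τ ^ 2) + n * τ ^ 2 < ∑ i, τ * Z c (η i)},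
      {η | n * (16 * τ ^ 2) + n * τ ^ 2 < ∑ i, τ * (W c (η i) - ∫ x, W c x ∂D)},
      {η | n * (16 * (-τ) ^ 2) + n * τ ^ 2 < ∑ i, (-τ) * (W c (η i) - ∫ x, W c x ∂D)},
      {η | n * (2 * Real.exp (-l)) + n * τ ^ 2 < ∑ i, max (W c (η i) - l) 0}]
  let S : Fin d → Set (EuclideanSpace ℝ (Fin d)) := fun j => {x | |x j| ≤ 1}
  have hS : ∀ j, MeasurableSet (S j) := fun j =>
    measurableSet_le (measurable_coord j).norm measurable_const
  let B : Fin d → Set (Fin n → EuclideanSpace ℝ (Fin d)) := fun j =>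
    {η | n * (-(τ * D.real (S j)) + τ ^ 2) + n * τ ^ 2 < ∑ i, -(τ * (S j).indicator 1 (η i))}
  have hA : ∀ c ∈ s, ∀ k, P (A c k) ≤ p := by
    intro c hc k
    fin_cases k
    · refine measure_pi_sum_gt_le ((hZ c).const_mul τ) ?_ n _
      refine (hD.lintegral_exp_inner_le c τ).trans
        (ENNReal.ofReal_le_ofReal (Real.exp_le_exp.2 ?_))
      have : ‖c‖ ^ 2 ≤ (3 / 2) ^ 2 := by gcongr; exact hs c hc
      nlinarith [sq_nonneg τ]
    · exact measure_pi_sum_gt_le (((hWm c).sub_const _).const_mul τ)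
        (lintegral_exp_mul_sub_integral_le (hWm c) (hW0 c) (hWexp c hc)
          (by rwa [abs_of_pos hτ])) n _
    · exact measure_pi_sum_gt_le (((hWm c).sub_const _).const_mul (-τ))
        (lintegral_exp_mul_sub_integral_le (hWm c) (hW0 c) (hWexp c hc)
          (by rwa [abs_neg, abs_of_pos hτ])) n _
    · exact measure_pi_sum_gt_le (((hWm c).sub_const _).max measurable_const)
        (lintegral_exp_max_sub_le (hWm c) (hWexp c hc) l) n _
  have hB : ∀ j, P (B j) ≤ p := fun j =>
    measure_pi_sum_gt_le ((measurable_one.indicator (hS j)).const_mul τ).neg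
      (lintegral_exp_neg_indicator_le (hS j) hτ.le (by linarith)) n _
  have hsub : {η | ¬ IsRegular D α ε τ η} ⊆ (⋃ c ∈ s, ⋃ k, A c k) ∪ ⋃ j, B j := by
    intro η hη
    by_contra hout
    simp only [Set.mem_union, Set.mem_iUnion, not_or, not_exists] at hout
    obtain ⟨hoA, hoB⟩ := hout
    refine hη ⟨?_, ?_, ?_, ?_⟩
    · refine sum_inner_le_of_net hnet fun c hc => ?_
      have h0 : ∑ i, τ * Z c (η i) ≤ n * (9 / 2 * τ ^ 2) + n * τ ^ 2 := not_lt.1 (hoA c hc 0)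
      rw [← Finset.mul_sum] at h0
      refine le_of_mul_le_mul_left (h0.trans ?_) hτ
      nlinarith [mul_pos hn' (pow_pos hτ 2)]
    · refine sq_dev_le_of_net hs hnet (fun c hc => ?_) hτ.le
      have h1 : ∑ i, τ * (W c (η i) - ∫ x, W c x ∂D) ≤ n * (16 * τ ^ 2) + n * τ ^ 2 :=
        not_lt.1 (hoA c hc 1)
      have h2 : ∑ i, (-τ) * (W c (η i) - ∫ x, W c x ∂D) ≤ n * (16 * (-τ) ^ 2) + n * τ ^ 2 :=
        not_lt.1 (hoA c hc 2)
      have e1 : ∑ i, (W c (η i) - ∫ x, W c x ∂D) =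
          n / 36 * ((∑ i, inner ℝ (huberGrad 2 (η i)) c ^ 2) / n
            - ∫ x, inner ℝ (huberGrad 2 x) c ^ 2 ∂D) := by
        simp only [W, Z]
        rw [Finset.sum_sub_distrib, ← Finset.sum_div, integral_div]
        simp only [Finset.sum_const, Finset.card_univ, Fintype.card_fin, nsmul_eq_mul]
        field_simp
      rw [← Finset.mul_sum, e1] at h1 h2
      set y := (∑ i, inner ℝ (huberGrad 2 (η i)) c ^ 2) / n
        - ∫ x, inner ℝ (huberGrad 2 x) c ^ 2 ∂D
      have hnτ : 0 < n * τ := mul_pos hn' hτ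
      rw [abs_le]
      constructor
      · refine le_of_mul_le_mul_left ?_ hnτ
        linarith
      · refine le_of_mul_le_mul_left ?_ hnτ
        linarith
    · intro v hv hsum u
      have h4 := fun c hc => sum_mul_le_of_sum_max_le (W := fun i => W c (η i))
        (b := 2 * ε + τ ^ 2) (l := l) hn hv hsum (by linarith) (by
          have : ∑ i, max (W c (η i) - l) 0 ≤ n * (2 * Real.exp (-l)) + n * τ ^ 2 :=
            not_lt.1 (hoA c hc 3)
          rw [hexpl] at this
          linarith)
      -- The factor `3` of the net gives `108 (2εl + 2ε + τ²)`, and `l ≥ 1` turns this into `432 (εl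
      -- + τ²)`.
      refine (weighted_sq_le_of_net (a := 36 * (2 * ε * l + (2 * ε + τ ^ 2))) hs hnet
        (fun i => (hv i).1) (fun c hc => ?_) u).trans ?_
      · have e : ∑ i, v i * inner ℝ (huberGrad 2 (η i)) c ^ 2 = 36 * ∑ i, v i * W c (η i) := by
          rw [Finset.mul_sum]
          refine Finset.sum_congr rfl fun i _ => ?_
          simp only [W, Z]
          ring
        rw [e]
        linarith [h4 c hc]
      · refine mul_le_mul_of_nonneg_right ?_ (sq_nonneg _)
        nlinarith [sq_nonneg τ]
    · intro j
      have h5 : ∑ i, -(τ * (S j).indicator 1 (η i)) ≤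
          n * (-(τ * D.real (S j)) + τ ^ 2) + n * τ ^ 2 := not_lt.1 (hoB j)
      rw [Finset.sum_neg_distrib, ← Finset.mul_sum] at h5
      have h6 := hD.small j
      refine le_of_mul_le_mul_left ?_ hτ
      have h7 : n * τ * α ≤ n * τ * D.real (S j) := by gcongr
      linarith
  refine (measure_mono hsub).trans ((measure_union_le _ _).trans ?_)
  have hsumA : P (⋃ c ∈ s, ⋃ k, A c k) ≤ (25 ^ d : ℕ) * (4 * p) := by
    refine (measure_biUnion_finset_le _ _).trans ?_
    calc ∑ c ∈ s, P (⋃ k, A c k) ≤ ∑ _c ∈ s, 4 * p := by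
          refine Finset.sum_le_sum fun c hc => (measure_iUnion_fintype_le _ _).trans ?_
          refine (Finset.sum_le_sum fun k _ => hA c hc k).trans ?_
          simp
      _ = s.card * (4 * p) := by simp
      _ ≤ _ := by gcongr
  -- Since `d ≤ 25 ^ d`, the coordinate events cost no more than a fifth event per net direction,
  -- whence the factor `5`.
  have hsumB : P (⋃ j, B j) ≤ (25 ^ d : ℕ) * p := by
    refine (measure_iUnion_fintype_le _ _).trans ((Finset.sum_le_sum fun j _ => hB j).trans ?_)
    simp only [Finset.sum_const, Finset.card_univ, Fintype.card_fin, nsmul_eq_mul]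
    gcongr
    exact (Nat.lt_pow_self (by norm_num)).le
  calc _ ≤ (25 ^ d : ℕ) * (4 * p) + (25 ^ d : ℕ) * p := add_le_add hsumA hsumB
    _ = ((5 * 25 ^ d : ℕ) : ENNReal) * p := by push_cast; ring
    _ = ENNReal.ofReal (5 * 25 ^ d * Real.exp (-(n * τ ^ 2))) := by
        rw [hp, ENNReal.ofReal_mul (by positivity), ← ENNReal.ofReal_natCast]
        push_cast
        rfl
    _ ≤ _ := ENNReal.ofReal_le_ofReal hδ

/-! ### Monotonicity, smoothness and minimizers of the Huber loss -/

lemma huberDeriv_two_eq_clip (t : ℝ) : huberDeriv 2 t = max (-2) (min t 2) := by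
  unfold huberDeriv
  split_ifs with h
  · rw [abs_le] at h
    rw [min_eq_left h.2, max_eq_right h.1]
  · rw [abs_le, not_and_or, not_le, not_le] at h
    rcases h with h | h
    · rw [Real.sign_of_neg (by linarith), min_eq_left (by linarith), max_eq_left h.le]; ring
    · rw [Real.sign_of_pos (by linarith), min_eq_right h.le, max_eq_right (by norm_num)]; ring

lemma huberDeriv_two_neg (t : ℝ) : huberDeriv 2 (-t) = -huberDeriv 2 t := by
  rw [huberDeriv_two_eq_sign_mul, huberDeriv_two_eq_sign_mul, Real.sign_neg, abs_neg]
  ring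

lemma huberDeriv_two_sub_mul_nonneg (a t : ℝ) :
    0 ≤ (huberDeriv 2 a - huberDeriv 2 (a - t)) * t := by
  rw [huberDeriv_two_eq_clip, huberDeriv_two_eq_clip]
  rcases le_total 0 t with ht | ht
  · exact mul_nonneg (by grind) ht
  · exact mul_nonneg_of_nonpos_of_nonpos (by grind) ht

lemma huberDeriv_two_sub_mul_le (a t : ℝ) :
    (huberDeriv 2 a - huberDeriv 2 (a - t)) * t ≤ t ^ 2 := by
  rw [huberDeriv_two_eq_clip, huberDeriv_two_eq_clip, sq]
  rcases le_total 0 t with ht | ht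
  · exact mul_le_mul_of_nonneg_right (by grind) ht
  · exact mul_le_mul_of_nonpos_right (by grind) ht

/-- Source of the curvature: for `|a|, |t| ≤ 1` both arguments lie in the linear range `[-2, 2]`.
For longer `t`, monotonicity preserves the unit increment. -/
lemma min_abs_le_huberDeriv_two_sub_mul {a : ℝ} (ha : |a| ≤ 1) (t : ℝ) :
    min |t| 1 * |t| ≤ (huberDeriv 2 a - huberDeriv 2 (a - t)) * t := by
  rw [huberDeriv_two_eq_clip, huberDeriv_two_eq_clip]
  rw [abs_le] at ha
  rcases le_total 0 t with ht | ht
  · rw [abs_of_nonneg ht]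
    exact mul_le_mul_of_nonneg_right (by grind) ht
  · rw [abs_of_nonpos ht, mul_neg, ← neg_mul]
    exact mul_le_mul_of_nonpos_right (by grind) ht

/-- The Huber loss is the infimal convolution of `t² / 2` and `2 |t|`; this is the inequality for an
arbitrary splitting, and `huber_two_eq` gives the optimal one. -/
lemma huber_two_le (x z : ℝ) : huber 2 x ≤ (x - z) ^ 2 / 2 + 2 * |z| := by
  unfold huber
  split_ifs with h
  · have h1 : x * z ≤ 2 * |z| := by
      calc x * z ≤ |x * z| := le_abs_self _
        _ = |x| * |z| := abs_mul _ _
        _ ≤ 2 * |z| := by gcongr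
    nlinarith [sq_nonneg z]
  · have h1 : |x| ≤ |x - z| + |z| := by simpa using abs_add_le (x - z) z
    nlinarith [sq_nonneg (|x - z| - 2), sq_abs (x - z)]

lemma huber_two_eq (x : ℝ) :
    huber 2 x = huberDeriv 2 x ^ 2 / 2 + 2 * |x - huberDeriv 2 x| := by
  unfold huber huberDeriv
  split_ifs with h
  · simp
  · rw [not_le, lt_abs] at h
    rcases h with h | h
    · rw [Real.sign_of_pos (by linarith), abs_of_pos (a := x) (by linarith),
        abs_of_pos (by linarith)]
      ring
    · rw [Real.sign_of_neg (by linarith), abs_of_neg (a := x) (by linarith),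
        abs_of_neg (by linarith)]
      ring

/-- The Huber loss is `1`-smooth. -/
lemma huber_two_add_le (x t : ℝ) :
    huber 2 (x + t) ≤ huber 2 x + huberDeriv 2 x * t + t ^ 2 / 2 := by
  -- The splitting optimal at `x` is used as a competitor at `x + t`.
  have h := huber_two_le (x + t) (x - huberDeriv 2 x)
  rw [huber_two_eq x]
  nlinarith

lemma two_mul_abs_sub_two_le_huber (x : ℝ) : 2 * |x| - 2 ≤ huber 2 x := by
  unfold huber
  split_ifs with h
  · nlinarith [sq_nonneg (|x| - 2), sq_abs x]
  · linarith

lemma huber_two_nonneg (x : ℝ) : 0 ≤ huber 2 x := by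
  rw [huber_two_eq]; positivity

lemma continuous_huberDeriv_two : Continuous (huberDeriv 2) := by
  have : huberDeriv 2 = fun t => max (-2) (min t 2) := funext huberDeriv_two_eq_clip
  rw [this]
  fun_prop

lemma continuous_huber_two : Continuous (huber 2) := by
  have : huber 2 = fun x => huberDeriv 2 x ^ 2 / 2 + 2 * |x - huberDeriv 2 x| :=
    funext huber_two_eq
  rw [this]
  have := continuous_huberDeriv_two
  fun_prop

lemma huberGrad_two_neg {d : ℕ} (x : EuclideanSpace ℝ (Fin d)) :
    huberGrad 2 (-x) = -huberGrad 2 x := by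
  ext j
  exact huberDeriv_two_neg (x j)

lemma huberLoss_two_add_le {d : ℕ} (x u : EuclideanSpace ℝ (Fin d)) :
    huberLoss 2 (x + u) ≤ huberLoss 2 x + inner ℝ (huberGrad 2 x) u + ‖u‖ ^ 2 / 2 := by
  rw [inner_huberGrad, EuclideanSpace.real_norm_sq_eq, Finset.sum_div]
  unfold huberLoss
  rw [← Finset.sum_add_distrib, ← Finset.sum_add_distrib]
  exact Finset.sum_le_sum fun j _ => huber_two_add_le _ _

/-- The first-order condition at a minimizer. -/
lemma IsMinimizer.sum_smul_huberGrad_eq_zero {d n : ℕ} {y : Fin n → EuclideanSpace ℝ (Fin d)}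
    {w : Fin n → ℝ} {μ : EuclideanSpace ℝ (Fin d)} (hμ : IsMinimizer 2 y w μ)
    (hw : ∀ i, 0 ≤ w i) (hw1 : ∑ i, w i ≤ 1) :
    ∑ i, w i • huberGrad 2 (y i - μ) = 0 := by
  set G := ∑ i, w i • huberGrad 2 (y i - μ) with hG
  -- A unit gradient step replaces differentiation: as the total weight is at most `1`, smoothness
  -- gives a decrease of at least `‖G‖² / 2`.
  have h1 := hμ (μ + G)
  have h2 : weightedLoss 2 y w (μ + G) ≤
      weightedLoss 2 y w μ - ‖G‖ ^ 2 + (∑ i, w i) * (‖G‖ ^ 2 / 2) := by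
    have e : ‖G‖ ^ 2 = ∑ i, w i * inner ℝ (huberGrad 2 (y i - μ)) G := by
      rw [← real_inner_self_eq_norm_sq]
      nth_rw 1 [hG]
      rw [sum_inner]
      exact Finset.sum_congr rfl fun i _ => real_inner_smul_left _ _ _
    nth_rw 1 [e]
    unfold weightedLoss
    rw [Finset.sum_mul, ← Finset.sum_sub_distrib, ← Finset.sum_add_distrib]
    refine Finset.sum_le_sum fun i _ => ?_
    have h3 := huberLoss_two_add_le (μ - y i) G
    rw [← neg_sub (y i) μ, huberGrad_two_neg, inner_neg_left] at h3
    rw [show μ + G - y i = -(y i - μ) + G by abel, show μ - y i = -(y i - μ) by abel]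
    nlinarith [mul_le_mul_of_nonneg_left h3 (hw i)]
  have h4 : (∑ i, w i) * (‖G‖ ^ 2 / 2) ≤ 1 * (‖G‖ ^ 2 / 2) := by gcongr
  have h5 : ‖G‖ ^ 2 ≤ 0 := by linarith
  exact norm_eq_zero.1 (pow_eq_zero_iff (two_ne_zero) |>.1 (le_antisymm h5 (sq_nonneg _)))

/-- A weighted Huber loss with nonzero weights attains its minimum. -/
lemma exists_isMinimizer {d n : ℕ} (y : Fin n → EuclideanSpace ℝ (Fin d)) {w : Fin n → ℝ}
    (hw : ∀ i, 0 ≤ w i) (hpos : 0 < ∑ i, w i) : ∃ μ, IsMinimizer 2 y w μ := by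
  obtain ⟨k, -, hk⟩ := Finset.exists_lt_of_sum_lt (s := Finset.univ) (f := fun _ => (0 : ℝ))
    (by simpa using hpos)
  have hcont : Continuous (weightedLoss 2 y w) := by
    unfold weightedLoss huberLoss
    have := continuous_huber_two
    fun_prop
  have hlower : ∀ μ, w k * (2 * (‖μ‖ - ‖y k‖) - 2 * d) ≤ weightedLoss 2 y w μ := by
    intro μ
    have h1 : ‖μ - y k‖ ≤ ∑ j, |(μ - y k) j| := by
      refine abs_le_of_sq_le_sq' ?_ (Finset.sum_nonneg fun _ _ => abs_nonneg _) |>.2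
      rw [EuclideanSpace.real_norm_sq_eq]
      simp_rw [← sq_abs ((μ - y k) _)]
      exact Finset.sum_sq_le_sq_sum_of_nonneg fun _ _ => abs_nonneg _
    have h2 : 2 * ‖μ - y k‖ - 2 * d ≤ huberLoss 2 (μ - y k) := by
      calc _ ≤ ∑ j : Fin d, (2 * |(μ - y k) j| - 2) := by
            rw [Finset.sum_sub_distrib, ← Finset.mul_sum]
            simp only [Finset.sum_const, Finset.card_univ, Fintype.card_fin, nsmul_eq_mul]
            linarith
        _ ≤ _ := Finset.sum_le_sum fun j _ => two_mul_abs_sub_two_le_huber _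
    calc _ ≤ w k * huberLoss 2 (μ - y k) := by
          gcongr
          linarith [norm_sub_norm_le μ (y k)]
      _ ≤ _ := Finset.single_le_sum (f := fun i => w i * huberLoss 2 (μ - y i))
          (fun i _ => mul_nonneg (hw i) (Finset.sum_nonneg fun j _ => huber_two_nonneg _))
          (Finset.mem_univ k)
  have htend : Filter.Tendsto (fun μ : EuclideanSpace ℝ (Fin d) =>
      w k * (2 * (‖μ‖ - ‖y k‖) - 2 * d)) (Filter.cocompact _) Filter.atTop := by
    refine Filter.Tendsto.const_mul_atTop hk ?_
    simp only [sub_eq_add_neg]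
    refine Filter.tendsto_atTop_add_const_right _ _ (Filter.Tendsto.const_mul_atTop two_pos ?_)
    exact Filter.tendsto_atTop_add_const_right _ _ tendsto_norm_cocompact_atTop
  have hev := (Filter.tendsto_atTop_mono hlower htend).eventually_ge_atTop (weightedLoss 2 y w 0)
  exact hcont.exists_forall_le' 0 hev

/-! ### Second moments in a direction and clean weights -/

lemma sum_sum_mul_le_specNorm {d : ℕ} (A : Matrix (Fin d) (Fin d) ℝ)
    (u : EuclideanSpace ℝ (Fin d)) :
    ∑ j, ∑ k, A j k * (u j * u k) ≤ specNorm A * ‖u‖ ^ 2 := by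
  have h1 : ∑ j, ∑ k, A j k * (u j * u k) =
      inner ℝ (Matrix.toEuclideanCLM (n := Fin d) (𝕜 := ℝ) A u) u := by
    simp only [PiLp.inner_apply, Matrix.ofLp_toEuclideanCLM, Matrix.mulVec, dotProduct,
      RCLike.inner_apply, conj_trivial, Finset.mul_sum]
    refine Finset.sum_congr rfl fun j _ => Finset.sum_congr rfl fun k _ => ?_
    ring
  rw [h1]
  refine (real_inner_le_norm _ _).trans ?_
  rw [sq, ← mul_assoc]
  gcongr
  exact ContinuousLinearMap.le_opNorm _ _

lemma sum_sum_clippedCov_mul {d n : ℕ} (y : Fin n → EuclideanSpace ℝ (Fin d)) (w : Fin n → ℝ)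
    (μ u : EuclideanSpace ℝ (Fin d)) :
    ∑ j, ∑ k, clippedCov 2 y w μ j k * (u j * u k) =
      ∑ i, w i * inner ℝ (huberGrad 2 (y i - μ)) u ^ 2 := by
  have h : ∀ i, w i * inner ℝ (huberGrad 2 (y i - μ)) u ^ 2 = ∑ j, ∑ k,
      w i * (huberGrad 2 (y i - μ) j * huberGrad 2 (y i - μ) k) * (u j * u k) := by
    intro i
    rw [inner_huberGrad, sq, Finset.sum_mul_sum, Finset.mul_sum]
    refine Finset.sum_congr rfl fun j _ => ?_
    rw [Finset.mul_sum]
    refine Finset.sum_congr rfl fun k _ => ?_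
    simp only [huberGrad]
    ring
  simp_rw [h, clippedCov, Matrix.of_apply, Finset.sum_mul]
  rw [Finset.sum_comm]
  simp_rw [Finset.sum_comm (s := (Finset.univ : Finset (Fin n)))]
  rw [Finset.sum_comm]

lemma sum_clippedCov_sub_noiseCov_le {d n : ℕ} (D : Measure (EuclideanSpace ℝ (Fin d)))
    [IsProbabilityMeasure D] (y : Fin n → EuclideanSpace ℝ (Fin d)) (w : Fin n → ℝ)
    (μ u : EuclideanSpace ℝ (Fin d)) :
    ∑ i, w i * inner ℝ (huberGrad 2 (y i - μ)) u ^ 2 - ∫ x, inner ℝ (huberGrad 2 x) u ^ 2 ∂D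
      ≤ specNorm (clippedCov 2 y w μ - noiseCov 2 D) * ‖u‖ ^ 2 := by
  refine le_trans (le_of_eq ?_) (sum_sum_mul_le_specNorm _ u)
  simp only [Matrix.sub_apply, sub_mul, Finset.sum_sub_distrib]
  rw [sum_sum_clippedCov_mul, integral_inner_huberGrad_sq]

/-- The weights of a corrupted sample split into a part carried by the clean points and a part of
small total mass. -/
lemma exists_clean_weights {d n : ℕ} {ε : ℝ} (hn : 0 < n)
    {x y : Fin n → EuclideanSpace ℝ (Fin d)} (hy : IsCorruption ε x y) {w : Fin n → ℝ}
    (hw : w ∈ weights n ε) :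
    ∃ a b : Fin n → ℝ, (∀ i, w i = a i + b i) ∧ (∀ i, 0 ≤ a i ∧ a i ≤ 1 / n) ∧ (∀ i, 0 ≤ b i) ∧
      ∑ i, b i ≤ ε ∧ ∑ i, (1 / n - a i) ≤ 2 * ε ∧ ∀ i, a i = 0 ∨ y i = x i := by
  classical
  have hn' : (0 : ℝ) < n := Nat.cast_pos.2 hn
  obtain ⟨hw01, hwsum⟩ := hw
  let g : Fin n → ℝ := fun i => if y i = x i then 1 else 0
  have hg : ∑ i, (1 - g i) ≤ ε * n := by
    have h1 : ∑ i, g i = (Set.ncard {i | y i = x i} : ℝ) := by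
      simp only [g]
      rw [Finset.sum_boole, ← Set.ncard_coe_finset]
      congr 2
      ext i
      simp
    rw [Finset.sum_sub_distrib, h1]
    simp only [Finset.sum_const, Finset.card_univ, Fintype.card_fin, nsmul_eq_mul, mul_one]
    have h2 : (1 - ε) * (n : ℝ) ≤ (Set.ncard {i | y i = x i} : ℝ) := hy
    linarith
  have hgn : ∑ i, 1 / n * (1 - g i) ≤ ε := by
    rw [← Finset.mul_sum, one_div_mul_eq_div, div_le_iff₀ hn']
    exact hg
  have hnn : (0 : ℝ) ≤ 1 / n := by positivity
  -- Restrict `w` to the uncorrupted and the corrupted indices. The mass missing from `a` is at most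
  -- `ε` from `w` itself plus `ε` from the corrupted indices.
  refine ⟨fun i => w i * g i, fun i => w i * (1 - g i), fun i => by ring, fun i => ?_,
    fun i => ?_, ?_, ?_, fun i => ?_⟩
  · by_cases h : y i = x i <;> simp only [g, h, if_true, if_false, mul_one, mul_zero]
    · exact hw01 i
    · exact ⟨le_rfl, hnn⟩
  · by_cases h : y i = x i <;> simp [g, h, (hw01 i).1]
  · refine le_trans (Finset.sum_le_sum fun i _ => ?_) hgn
    refine mul_le_mul_of_nonneg_right (hw01 i).2 ?_
    by_cases h : y i = x i <;> simp [g, h]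
  · calc ∑ i, (1 / n - w i * g i) ≤ ∑ i, (|w i - 1 / n| + 1 / n * (1 - g i)) := by
          refine Finset.sum_le_sum fun i _ => ?_
          by_cases h : y i = x i <;> simp only [g, h, if_true, if_false, mul_one, mul_zero]
          · linarith [neg_abs_le (w i - 1 / n)]
          · linarith [abs_nonneg (w i - 1 / n)]
      _ ≤ ε + ε := by rw [Finset.sum_add_distrib]; exact add_le_add hwsum hgn
      _ = 2 * ε := by ring
  · by_cases h : y i = x i <;> simp [g, h]

lemma sq_sum_mul_le {ι : Type*} (s : Finset ι) {a : ι → ℝ} (ha : ∀ i, 0 ≤ a i) (q : ι → ℝ) :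
    (∑ i ∈ s, a i * q i) ^ 2 ≤ (∑ i ∈ s, a i) * ∑ i ∈ s, a i * q i ^ 2 :=
  Finset.sum_sq_le_sum_mul_sum_of_sq_le_mul s (fun i _ => ha i)
    (fun i _ => mul_nonneg (ha i) (sq_nonneg _)) (fun i _ => le_of_eq (by ring))

/-! ### Deterministic error bound for regular samples -/

section Error

variable {d n : ℕ} {D : Measure (EuclideanSpace ℝ (Fin d))} {α ε τ : ℝ}
  {η : Fin n → EuclideanSpace ℝ (Fin d)} {a b : Fin n → ℝ}
  {z : Fin n → EuclideanSpace ℝ (Fin d)} {Δ : EuclideanSpace ℝ (Fin d)}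

/-- The sampled fraction is at least `α - 2τ` and at most `2ε` of weight is missing, leaving `α (1 -
2/100 - 2/100)`. -/
lemma IsRegular.mass_le (hreg : IsRegular D α ε τ η) (hn : 0 < n) (hτ : τ ≤ α / 100)
    (hεα : ε ≤ α / 100) (ha : ∀ i, 0 ≤ a i ∧ a i ≤ 1 / n)
    (hasum : ∑ i, (1 / n - a i) ≤ 2 * ε) (j : Fin d) :
    24 / 25 * α ≤ ∑ i, a i * {x : EuclideanSpace ℝ (Fin d) | |x j| ≤ 1}.indicator 1 (η i) := by
  have hn' : (0 : ℝ) < n := Nat.cast_pos.2 hn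
  have h1 := hreg.small j
  set S : Set (EuclideanSpace ℝ (Fin d)) := {x | |x j| ≤ 1}
  have hpt : ∀ i, 1 / n * S.indicator 1 (η i) - (1 / n - a i) ≤
      a i * S.indicator (1 : EuclideanSpace ℝ (Fin d) → ℝ) (η i) := by
    intro i
    by_cases h : η i ∈ S
    · simp [h]
    · simp [h]
      simpa using (ha i).2
  have h2 := Finset.sum_le_sum fun i (_ : i ∈ Finset.univ) => hpt i
  rw [Finset.sum_sub_distrib, ← Finset.mul_sum] at h2
  have h3 : α - 2 * τ ≤ 1 / n * ∑ i, S.indicator 1 (η i) := by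
    rw [one_div_mul_eq_div, le_div_iff₀ hn']
    linarith
  linarith

/-- Every coordinate of the error is at most `1`. -/
lemma IsRegular.abs_coord_le_one (hreg : IsRegular D α ε τ η) (hn : 0 < n) (hα : 0 < α)
    (hτ : τ ≤ α / 100) (hεα : ε ≤ α / 100) (ha : ∀ i, 0 ≤ a i ∧ a i ≤ 1 / n)
    (hasum : ∑ i, (1 / n - a i) ≤ 2 * ε) (hb : ∀ i, 0 ≤ b i) (hbsum : ∑ i, b i ≤ ε)
    (hfoc : ∑ i, a i • huberGrad 2 (η i - Δ) + ∑ i, b i • huberGrad 2 (z i) = 0) (j : Fin d) :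
    |Δ j| ≤ 1 := by
  by_contra! hj
  have hn' : (0 : ℝ) < n := Nat.cast_pos.2 hn
  have hfocj : ∑ i, a i * huberDeriv 2 (η i j - Δ j) + ∑ i, b i * huberDeriv 2 (z i j) = 0 := by
    have := congrArg (fun v : EuclideanSpace ℝ (Fin d) => v j) hfoc
    simpa [huberGrad] using this
  have hmass := hreg.mass_le hn hτ hεα ha hasum j
  set S : Set (EuclideanSpace ℝ (Fin d)) := {x | |x j| ≤ 1}
  -- If `|Δ j| > 1`, each small entry contributes at least `|Δ j|` to the curvature. The opposing
  -- terms sum to at most `(8τ + 6ε) |Δ j|`, with `2ε` from corrupted and `4ε` from missing weight,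
  -- and `14/100 < 24/25`.
  have h1 : (∑ i, a i * S.indicator 1 (η i)) * |Δ j| ≤
      ∑ i, a i * ((huberDeriv 2 (η i j) - huberDeriv 2 (η i j - Δ j)) * Δ j) := by
    rw [Finset.sum_mul]
    refine Finset.sum_le_sum fun i _ => ?_
    rw [mul_assoc]
    refine mul_le_mul_of_nonneg_left ?_ (ha i).1
    by_cases h : η i ∈ S
    · have := min_abs_le_huberDeriv_two_sub_mul (a := η i j) h (Δ j)
      rw [min_eq_right hj.le] at this
      simpa [h] using this
    · simpa [h] using huberDeriv_two_sub_mul_nonneg (η i j) (Δ j)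
  have h2 : ∑ i, a i * ((huberDeriv 2 (η i j) - huberDeriv 2 (η i j - Δ j)) * Δ j) =
      (∑ i, a i * huberDeriv 2 (η i j)) * Δ j + (∑ i, b i * huberDeriv 2 (z i j)) * Δ j := by
    have e : ∑ i, a i * ((huberDeriv 2 (η i j) - huberDeriv 2 (η i j - Δ j)) * Δ j) =
        (∑ i, a i * huberDeriv 2 (η i j)) * Δ j
          - (∑ i, a i * huberDeriv 2 (η i j - Δ j)) * Δ j := by
      rw [Finset.sum_mul, Finset.sum_mul, ← Finset.sum_sub_distrib]
      exact Finset.sum_congr rfl fun i _ => by ring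
    rw [e]
    linear_combination -Δ j * hfocj
  have h3 : (∑ i, b i * huberDeriv 2 (z i j)) * Δ j ≤ 2 * ε * |Δ j| := by
    refine (le_abs_self _).trans ?_
    rw [abs_mul]
    refine mul_le_mul_of_nonneg_right ?_ (abs_nonneg _)
    calc _ ≤ ∑ i, b i * 2 := by
          refine (Finset.abs_sum_le_sum_abs _ _).trans (Finset.sum_le_sum fun i _ => ?_)
          rw [abs_mul, abs_of_nonneg (hb i)]
          exact mul_le_mul_of_nonneg_left (abs_huberDeriv_two_le _) (hb i)
      _ ≤ _ := by rw [← Finset.sum_mul]; linarith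
  have h4 : (∑ i, (1 / n - a i) * huberDeriv 2 (η i j)) * Δ j ≥ -(4 * ε * |Δ j|) := by
    refine le_trans ?_ (neg_abs_le _)
    rw [abs_mul]
    refine neg_le_neg (mul_le_mul_of_nonneg_right ?_ (abs_nonneg _))
    calc _ ≤ ∑ i, (1 / n - a i) * 2 := by
          refine (Finset.abs_sum_le_sum_abs _ _).trans (Finset.sum_le_sum fun i _ => ?_)
          have h0 : 0 ≤ 1 / n - a i := by linarith [(ha i).2]
          rw [abs_mul, abs_of_nonneg h0]
          exact mul_le_mul_of_nonneg_left (abs_huberDeriv_two_le _) h0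
      _ ≤ _ := by rw [← Finset.sum_mul]; linarith
  have h5 : 1 / n * (∑ i, huberDeriv 2 (η i j)) * Δ j ≤ 8 * τ * |Δ j| := by
    have := hreg.sum_le (EuclideanSpace.single j (Δ j))
    simp only [inner_huberGrad] at this
    rw [PiLp.norm_single, Real.norm_eq_abs] at this
    simp only [PiLp.single_apply, mul_ite, mul_zero, Finset.sum_ite_eq', Finset.mem_univ,
      if_true] at this
    rw [← Finset.sum_mul] at this
    rw [mul_assoc, one_div_mul_eq_div, div_le_iff₀ hn']
    linarith
  have h6 : ∑ i, a i * huberDeriv 2 (η i j) =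
      1 / n * (∑ i, huberDeriv 2 (η i j)) - ∑ i, (1 / n - a i) * huberDeriv 2 (η i j) := by
    rw [Finset.mul_sum, ← Finset.sum_sub_distrib]
    exact Finset.sum_congr rfl fun i _ => by ring
  have hΔ : 0 < |Δ j| := by linarith
  rw [h2, h6, sub_mul] at h1
  have h7 : 24 / 25 * α * |Δ j| ≤ (∑ i, a i * S.indicator 1 (η i)) * |Δ j| := by gcongr
  have h8 : 24 / 25 * α * |Δ j| ≤ (8 * τ + 6 * ε) * |Δ j| := by linarith
  have h9 := le_of_mul_le_mul_right h8 hΔ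
  linarith

/-- The self-bounding inequality for the curvature `B` of the loss in the direction of the
error. -/
lemma IsRegular.curvature_bounds [IsProbabilityMeasure D] (hD : IsSemiProduct α 1 D)
    (hreg : IsRegular D α ε τ η) (hn : 0 < n) (hα : 0 < α) (hα1 : α ≤ 1) (hε : 0 < ε)
    (hlog : 0 ≤ Real.log (1 / ε)) (hτ0 : 0 < τ)
    (hτ : τ ≤ α / 100) (hεα : ε ≤ α / 100) (ha : ∀ i, 0 ≤ a i ∧ a i ≤ 1 / n)
    (hasum : ∑ i, (1 / n - a i) ≤ 2 * ε) (hb : ∀ i, 0 ≤ b i) (hbsum : ∑ i, b i ≤ ε)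
    (hfoc : ∑ i, a i • huberGrad 2 (η i - Δ) + ∑ i, b i • huberGrad 2 (z i) = 0) {S : ℝ}
    (hS : ∑ i, a i * inner ℝ (huberGrad 2 (η i - Δ)) Δ ^ 2
      + ∑ i, b i * inner ℝ (huberGrad 2 (z i)) Δ ^ 2
      - ∫ x, inner ℝ (huberGrad 2 x) Δ ^ 2 ∂D ≤ S * ‖Δ‖ ^ 2) :
    ∃ B : ℝ, 0 ≤ B ∧ 24 / 25 * α * ‖Δ‖ ^ 2 ≤ B ∧
      B ≤ ‖Δ‖ * (8 * τ + √(2 * ε * (432 * (ε * Real.log (1 / ε) + τ ^ 2)))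
        + √(ε * (S + 2000 * τ + 432 * (ε * Real.log (1 / ε) + τ ^ 2) + 12 * √B))) := by
  have hn' : (0 : ℝ) < n := Nat.cast_pos.2 hn
  set l := Real.log (1 / ε)
  set r := ‖Δ‖ with hr
  have hr0 : 0 ≤ r := norm_nonneg _
  set M := 432 * (ε * l + τ ^ 2) with hM
  set v : Fin n → ℝ := fun i => 1 / n - a i with hvdef
  have hv : ∀ i, 0 ≤ v i ∧ v i ≤ 1 / n := fun i =>
    ⟨sub_nonneg.2 (ha i).2, by simp only [v]; linarith [(ha i).1]⟩
  set q : Fin n → ℝ := fun i => inner ℝ (huberGrad 2 (η i)) Δ with hq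
  set p : Fin n → ℝ := fun i => inner ℝ (huberGrad 2 (η i - Δ)) Δ with hp
  set c : Fin n → ℝ := fun i => inner ℝ (huberGrad 2 (z i)) Δ with hc
  set m := ∫ x, inner ℝ (huberGrad 2 x) Δ ^ 2 ∂D with hm
  have hβ : ∀ i, q i - p i =
      ∑ j, (huberDeriv 2 (η i j) - huberDeriv 2 (η i j - Δ j)) * Δ j := by
    intro i
    simp only [q, p, inner_huberGrad, ← Finset.sum_sub_distrib, sub_mul, PiLp.sub_apply]
  have hβ0 : ∀ i, 0 ≤ q i - p i := fun i => by
    rw [hβ]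
    exact Finset.sum_nonneg fun j _ => huberDeriv_two_sub_mul_nonneg _ _
  have hβ1 : ∀ i, q i - p i ≤ r ^ 2 := fun i => by
    rw [hβ, hr, EuclideanSpace.real_norm_sq_eq]
    exact Finset.sum_le_sum fun j _ => huberDeriv_two_sub_mul_le _ _
  have hcoord := hreg.abs_coord_le_one hn hα hτ hεα ha hasum hb hbsum hfoc
  set B := ∑ i, a i * (q i - p i) with hB
  have hB0 : 0 ≤ B := Finset.sum_nonneg fun i _ => mul_nonneg (ha i).1 (hβ0 i)
  have hBlow : 24 / 25 * α * r ^ 2 ≤ B := by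
    have e : B = ∑ j, ∑ i, a i * ((huberDeriv 2 (η i j) - huberDeriv 2 (η i j - Δ j)) * Δ j) := by
      rw [Finset.sum_comm, hB]
      simp_rw [hβ, Finset.mul_sum]
    rw [e, hr, EuclideanSpace.real_norm_sq_eq, Finset.mul_sum]
    refine Finset.sum_le_sum fun j _ => ?_
    refine (mul_le_mul_of_nonneg_right (hreg.mass_le hn hτ hεα ha hasum j) (sq_nonneg _)).trans ?_
    rw [Finset.sum_mul]
    refine Finset.sum_le_sum fun i _ => ?_
    rw [mul_assoc]
    refine mul_le_mul_of_nonneg_left ?_ (ha i).1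
    by_cases h : η i ∈ {x : EuclideanSpace ℝ (Fin d) | |x j| ≤ 1}
    · have := min_abs_le_huberDeriv_two_sub_mul (a := η i j) h (Δ j)
      rw [min_eq_left (hcoord j), ← sq, sq_abs] at this
      rw [Set.indicator_of_mem h, Pi.one_apply, one_mul]
      exact this
    · rw [Set.indicator_of_notMem h, zero_mul]
      exact huberDeriv_two_sub_mul_nonneg (η i j) (Δ j)
  have hBeq : B = ∑ i, a i * q i + ∑ i, b i * c i := by
    have e := congrArg (fun u => inner ℝ u Δ) hfoc
    simp only [inner_add_left, sum_inner, real_inner_smul_left, inner_zero_left] at e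
    simp only [hB, mul_sub, Finset.sum_sub_distrib]
    linarith
  have hvq2 : ∑ i, v i * q i ^ 2 ≤ M * r ^ 2 := hreg.stable v hv hasum Δ
  have hM0 : 0 ≤ M := by positivity
  have haq : ∑ i, a i * q i ≤ r * (8 * τ) + r * √(2 * ε * M) := by
    have e : ∑ i, a i * q i = 1 / n * ∑ i, q i - ∑ i, v i * q i := by
      rw [Finset.mul_sum, ← Finset.sum_sub_distrib]
      exact Finset.sum_congr rfl fun i _ => by simp only [v]; ring
    have h1 : 1 / n * ∑ i, q i ≤ 8 * τ * r := by
      rw [one_div_mul_eq_div, div_le_iff₀ hn']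
      linarith [hreg.sum_le Δ]
    have h2 : -∑ i, v i * q i ≤ r * √(2 * ε * M) := by
      refine (neg_le_abs _).trans (abs_le_of_sq_le_sq ?_ (by positivity))
      rw [mul_pow, Real.sq_sqrt (by positivity)]
      refine (sq_sum_mul_le _ (fun i => (hv i).1) q).trans ?_
      calc _ ≤ 2 * ε * (M * r ^ 2) := mul_le_mul hasum hvq2
            (Finset.sum_nonneg fun i _ => mul_nonneg (hv i).1 (sq_nonneg _)) (by positivity)
        _ = _ := by ring
    linarith
  have haq2 : ∑ i, a i * q i ^ 2 = (∑ i, q i ^ 2) / n - ∑ i, v i * q i ^ 2 := by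
    rw [Finset.sum_div, ← Finset.sum_sub_distrib]
    exact Finset.sum_congr rfl fun i _ => by simp only [v]; ring
  have hdev := abs_le.1 (hreg.sq_dev Δ)
  have haq2up : ∑ i, a i * q i ^ 2 ≤ 36 * r ^ 2 := by
    have h1 : 0 ≤ ∑ i, v i * q i ^ 2 :=
      Finset.sum_nonneg fun i _ => mul_nonneg (hv i).1 (sq_nonneg _)
    have h2 : m ≤ 16 * r ^ 2 := hD.integral_inner_sq_le Δ
    have h3 : 2000 * τ * r ^ 2 ≤ 20 * r ^ 2 := by
      refine mul_le_mul_of_nonneg_right ?_ (sq_nonneg _)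
      linarith
    rw [haq2]
    linarith [hdev.2]
  -- The self-bounding step: `0 ≤ q - p ≤ r²` gives `(q - p)² ≤ r² (q - p)`, so Cauchy–Schwarz
  -- bounds the sum by the root of `r² B · 36 r²`.
  have hcross : ∑ i, a i * ((q i - p i) * q i) ≤ 6 * r ^ 2 * √B := by
    refine (le_abs_self _).trans (abs_le_of_sq_le_sq ?_ (by positivity))
    have h1 : (∑ i, a i * ((q i - p i) * q i)) ^ 2 ≤
        (∑ i, a i * (q i - p i) ^ 2) * ∑ i, a i * q i ^ 2 :=
      Finset.sum_sq_le_sum_mul_sum_of_sq_le_mul _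
        (fun i _ => mul_nonneg (ha i).1 (sq_nonneg _))
        (fun i _ => mul_nonneg (ha i).1 (sq_nonneg _)) (fun i _ => le_of_eq (by ring))
    have h2 : ∑ i, a i * (q i - p i) ^ 2 ≤ r ^ 2 * B := by
      rw [hB, Finset.mul_sum]
      refine Finset.sum_le_sum fun i _ => ?_
      nlinarith [mul_nonneg (mul_nonneg (ha i).1 (hβ0 i)) (sub_nonneg.2 (hβ1 i))]
    refine h1.trans ((mul_le_mul h2 haq2up
      (Finset.sum_nonneg fun i _ => mul_nonneg (ha i).1 (sq_nonneg _)) (by positivity)).trans ?_)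
    rw [mul_pow, Real.sq_sqrt hB0]
    exact le_of_eq (by ring)
  -- The clean second moment at `μhat` is bounded below through `p² ≥ q² - 2 (q - p) q`; subtracting
  -- it from the full one leaves the corrupted part.
  have hbc2 : ∑ i, b i * c i ^ 2 ≤ r ^ 2 * (S + 2000 * τ + M + 12 * √B) := by
    have h1 : ∑ i, a i * q i ^ 2 - 2 * ∑ i, a i * ((q i - p i) * q i) ≤ ∑ i, a i * p i ^ 2 := by
      rw [Finset.mul_sum, ← Finset.sum_sub_distrib]
      refine Finset.sum_le_sum fun i _ => ?_
      nlinarith [mul_nonneg (ha i).1 (sq_nonneg (q i - p i))]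
    linarith [hdev.1]
  have hbc : ∑ i, b i * c i ≤ r * √(ε * (S + 2000 * τ + M + 12 * √B)) := by
    have h0 : 0 ≤ ∑ i, b i * c i ^ 2 :=
      Finset.sum_nonneg fun i _ => mul_nonneg (hb i) (sq_nonneg _)
    rw [← Real.sqrt_sq hr0, ← Real.sqrt_mul (sq_nonneg r)]
    refine Real.le_sqrt_of_sq_le ((sq_sum_mul_le _ hb c).trans ?_)
    calc _ ≤ ε * ∑ i, b i * c i ^ 2 := mul_le_mul_of_nonneg_right hbsum h0
      _ ≤ ε * (r ^ 2 * (S + 2000 * τ + M + 12 * √B)) := by gcongr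
      _ = _ := by ring
  exact ⟨B, hB0, hBlow, by linarith⟩

end Error

/-- Resolution of the self-bounding inequality. -/
lemma le_of_self_bound {r s τ ε e l S B : ℝ} (hr : 0 ≤ r) (hs : 0 < s) (hs1 : s ≤ 1)
    (hτ : 0 ≤ τ) (hτ1 : τ ≤ 1) (hε : 0 < ε) (hε1 : ε ≤ 1) (hl : 1 ≤ l) (hS : 0 ≤ S)
    (hB : 0 ≤ B) (he : e = √(ε * (S + ε * l))) (hlow : 24 / 25 * s ^ 2 * r ^ 2 ≤ B)
    (hup : B ≤ r * (8 * τ + √(2 * ε * (432 * (ε * l + τ ^ 2)))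
      + √(ε * (S + 2000 * τ + 432 * (ε * l + τ ^ 2) + 12 * √B)))) :
    r ≤ 150 * (τ / s ^ 2) + 200 * (e / s ^ 3) := by
  have he0 : 0 ≤ e := he ▸ Real.sqrt_nonneg _
  have hl0 : 0 ≤ ε * l := by positivity
  have hesq : e ^ 2 = ε * (S + ε * l) := by rw [he, Real.sq_sqrt (by positivity)]
  have hεe : ε ≤ e := by
    rw [he]
    refine Real.le_sqrt_of_sq_le ?_
    nlinarith
  set x := √B with hx
  have hx0 : 0 ≤ x := Real.sqrt_nonneg _
  have hxB : x ^ 2 = B := Real.sq_sqrt hB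
  set y := √(12 * ε * x) with hy
  have hy0 : 0 ≤ y := Real.sqrt_nonneg _
  have hysq : y ^ 2 = 12 * ε * x := Real.sq_sqrt (by positivity)
  have hrx : 97 / 100 * (s * r) ≤ x := by
    refine abs_le_of_sq_le_sq' ?_ hx0 |>.2
    rw [hxB]
    nlinarith [mul_nonneg (sq_nonneg s) (sq_nonneg r)]
  have h1 : √(2 * ε * (432 * (ε * l + τ ^ 2))) ≤ 30 * e + 30 * τ := by
    refine Real.sqrt_le_iff.2 ⟨by positivity, ?_⟩
    have : ε * τ ^ 2 ≤ 1 * τ ^ 2 := by gcongr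
    nlinarith [mul_nonneg he0 hτ, mul_nonneg hε.le hS, sq_nonneg e, sq_nonneg τ]
  have h2 : √(ε * (S + 2000 * τ + 432 * (ε * l + τ ^ 2) + 12 * x)) ≤ 46 * e + 25 * τ + y := by
    refine Real.sqrt_le_iff.2 ⟨by positivity, ?_⟩
    have h3 : ε * τ ^ 2 ≤ ε * τ := by
      refine mul_le_mul_of_nonneg_left ?_ hε.le
      nlinarith
    have h4 : ε * τ ≤ e * τ := by gcongr
    have h5 : 0 ≤ (46 * e + 25 * τ) * y := by positivity
    nlinarith [mul_nonneg hε.le hS, sq_nonneg e, sq_nonneg τ, mul_nonneg he0 hτ]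
  have h3 : x ^ 2 ≤ r * (63 * τ + 76 * e + y) := by
    rw [hxB]
    refine hup.trans (mul_le_mul_of_nonneg_left ?_ hr)
    linarith
  -- Trade `s r` for `x` by the lower bound on `B`, then cancel one factor `x`.
  have h4 : 97 / 100 * s * x ≤ 63 * τ + 76 * e + y := by
    rcases hx0.eq_or_lt with h0 | h0
    · rw [← h0, mul_zero]; positivity
    · refine le_of_mul_le_mul_left ?_ h0
      have h5 : s * x ^ 2 ≤ (s * r) * (63 * τ + 76 * e + y) := by
        calc s * x ^ 2 ≤ s * (r * (63 * τ + 76 * e + y)) := by gcongr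
          _ = _ := by ring
      have h6 : 97 / 100 * (s * r) * (63 * τ + 76 * e + y) ≤ x * (63 * τ + 76 * e + y) := by
        gcongr
      linarith
  -- AM–GM with `ε ≤ e`: the coefficient is half of the `97/100` in `h4`, so this term is absorbed,
  -- and `4 · (97/200) · 7 ≥ 12`.
  have h5 : s * y ≤ 97 / 200 * s ^ 2 * x + 7 * e := by
    refine abs_le_of_sq_le_sq' ?_ (by positivity) |>.2
    have h6 : s ^ 2 * (ε * x) ≤ s ^ 2 * (e * x) := by gcongr
    have h7 : (s * y) ^ 2 = 12 * (s ^ 2 * (ε * x)) := by rw [mul_pow, hysq]; ring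
    rw [h7]
    nlinarith [sq_nonneg (97 / 200 * s ^ 2 * x - 7 * e)]
  have h6 : 97 / 200 * s ^ 2 * x ≤ s * (63 * τ + 76 * e) + 7 * e := by
    have := mul_le_mul_of_nonneg_left h4 hs.le
    nlinarith
  have h7 : s ^ 3 * r ≤ 150 * (s * τ) + 200 * e := by
    have h8 : 97 / 100 * (s ^ 3 * r) ≤ s ^ 2 * x := by
      have := mul_le_mul_of_nonneg_left hrx (sq_nonneg s)
      linarith
    have h9 : s * e ≤ 1 * e := by gcongr
    linarith [mul_nonneg hs.le hτ]
  have h8 : 150 * (τ / s ^ 2) + 200 * (e / s ^ 3) = (150 * (s * τ) + 200 * e) / s ^ 3 := by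
    field_simp
  rw [h8, le_div_iff₀ (by positivity)]
  linarith

/-- The error bound for a regular noise sample. -/
lemma IsRegular.norm_sub_le {d n : ℕ} {α ε τ : ℝ} {D : Measure (EuclideanSpace ℝ (Fin d))}
    [IsProbabilityMeasure D] (hD : IsSemiProduct α 1 D) {η : Fin n → EuclideanSpace ℝ (Fin d)}
    (hreg : IsRegular D α ε τ η) (hn : 0 < n) (hα : 0 < α) (hα1 : α ≤ 1) (hε : 0 < ε)
    (hlog : 1 ≤ Real.log (1 / ε)) (hτ0 : 0 < τ) (hτ : τ ≤ α / 100) (hεα : ε ≤ α / 100)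
    {μstar μhat : EuclideanSpace ℝ (Fin d)} {y : Fin n → EuclideanSpace ℝ (Fin d)}
    (hy : IsCorruption ε (fun i => μstar + η i) y) {w : Fin n → ℝ} (hw : w ∈ weights n ε)
    (hmin : IsMinimizer 2 y w μhat) :
    ‖μhat - μstar‖ ≤ 150 * (τ / α) + 200 * (α ^ (-(3 / 2) : ℝ) *
      √(ε * (specNorm (clippedCov 2 y w μhat - noiseCov 2 D) + ε * Real.log (1 / ε)))) := by
  have hn' : (0 : ℝ) < n := Nat.cast_pos.2 hn
  obtain ⟨a, b, hab, ha, hb, hbsum, hasum, hclean⟩ := exists_clean_weights hn hy hw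
  have hw1 : ∑ i, w i ≤ 1 := by
    refine (Finset.sum_le_sum fun i _ => (hw.1 i).2).trans (le_of_eq ?_)
    simp only [Finset.sum_const, Finset.card_univ, Fintype.card_fin, nsmul_eq_mul]
    field_simp
  have hgrad : ∀ i, a i = 0 ∨ huberGrad 2 (y i - μhat) = huberGrad 2 (η i - (μhat - μstar)) := by
    intro i
    refine (hclean i).imp_right fun h => ?_
    rw [h]
    congr 1
    abel
  have hfoc : ∑ i, a i • huberGrad 2 (η i - (μhat - μstar))
      + ∑ i, b i • huberGrad 2 (y i - μhat) = 0 := by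
    rw [← hmin.sum_smul_huberGrad_eq_zero (fun i => (hw.1 i).1) hw1, ← Finset.sum_add_distrib]
    refine Finset.sum_congr rfl fun i _ => ?_
    rw [hab i, add_smul]
    rcases hgrad i with h | h
    · simp [h]
    · rw [h]
  have hS := sum_clippedCov_sub_noiseCov_le D y w μhat (μhat - μstar)
  have hsplit : ∑ i, w i * inner ℝ (huberGrad 2 (y i - μhat)) (μhat - μstar) ^ 2 =
      ∑ i, a i * inner ℝ (huberGrad 2 (η i - (μhat - μstar))) (μhat - μstar) ^ 2
        + ∑ i, b i * inner ℝ (huberGrad 2 (y i - μhat)) (μhat - μstar) ^ 2 := by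
    rw [← Finset.sum_add_distrib]
    refine Finset.sum_congr rfl fun i _ => ?_
    rw [hab i, add_mul]
    rcases hgrad i with h | h
    · simp [h]
    · rw [h]
  rw [hsplit] at hS
  obtain ⟨B, hB0, hBlow, hBup⟩ := hreg.curvature_bounds hD hn hα hα1 hε (by linarith) hτ0 hτ hεα
    ha hasum hb hbsum hfoc hS
  have hsq : √α ^ 2 = α := Real.sq_sqrt hα.le
  have hpow : α ^ (-(3 / 2) : ℝ) = 1 / √α ^ 3 := by
    rw [Real.rpow_neg hα.le, Real.sqrt_eq_rpow, ← Real.rpow_mul_natCast hα.le, one_div]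
    norm_num
  have := le_of_self_bound (r := ‖μhat - μstar‖) (s := √α)
    (S := specNorm (clippedCov 2 y w μhat - noiseCov 2 D)) (norm_nonneg _) (Real.sqrt_pos.2 hα)
    (Real.sqrt_le_one.2 hα1) hτ0.le (by linarith) hε (by linarith) hlog (norm_nonneg _) hB0 rfl
    (by rwa [hsq]) hBup
  rw [hsq] at this
  refine this.trans (le_of_eq ?_)
  rw [hpow]
  ring

/-! ### Choice of the deviation level and conclusion -/

/-- The exponent needed for the union bound is controlled by the dimension and the confidence. -/
lemma log_union_le {d : ℕ} {δ : ℝ} (hd : 0 < d) (hδ : 0 < δ) (hδ1 : δ < 1)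
    (h : 2 ≤ d ∨ δ ≤ 1 / 2) :
    d * Real.log 25 + Real.log (5 / δ) ≤ 8 * (d * Real.log d + Real.log (1 / δ)) := by
  have h25 : Real.log 25 ≤ 5 * Real.log 2 := by
    rw [← Real.log_rpow two_pos]
    exact Real.log_le_log (by norm_num) (by norm_num)
  have h5 : Real.log 5 ≤ 3 * Real.log 2 := by
    rw [← Real.log_rpow two_pos]
    exact Real.log_le_log (by norm_num) (by norm_num)
  have h25_5 : Real.log 25 + Real.log 5 ≤ 7 * Real.log 2 := by
    rw [← Real.log_rpow two_pos, ← Real.log_mul (by norm_num) (by norm_num)]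
    exact Real.log_le_log (by norm_num) (by norm_num)
  have h2 : 0 < Real.log 2 := Real.log_pos one_lt_two
  have e5 : Real.log (5 / δ) = Real.log 5 + Real.log (1 / δ) := by
    rw [Real.log_div (by norm_num) hδ.ne', Real.log_div (by norm_num) hδ.ne', Real.log_one]
    ring
  have hδ0 : 0 < Real.log (1 / δ) := Real.log_pos (by rw [lt_div_iff₀ hδ]; linarith)
  rw [e5]
  rcases Nat.lt_or_ge d 2 with hd2 | hd2
  -- Here `d log d = 0`, so `log (1/δ) ≥ log 2` must pay for the constants `log 25 + log 5 ≤ 7 log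
  -- 2`.
  · have hd1 : d = 1 := by omega
    have hδ2 : δ ≤ 1 / 2 := h.resolve_left (by omega)
    have hlog : Real.log 2 ≤ Real.log (1 / δ) := by
      refine Real.log_le_log two_pos ?_
      rw [le_div_iff₀ hδ]
      linarith
    subst hd1
    simp only [Nat.cast_one, one_mul, Real.log_one]
    linarith
  · have hd2' : (2 : ℝ) ≤ d := by exact_mod_cast hd2
    have hlog : Real.log 2 ≤ Real.log d := Real.log_le_log two_pos hd2'
    have h1 : (d : ℝ) * Real.log 25 ≤ d * (5 * Real.log d) := by gcongr; linarith
    have h3 : 2 * Real.log 2 ≤ d * Real.log d := by gcongr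
    linarith

lemma sum_weights_pos {n : ℕ} {ε : ℝ} (hn : 0 < n) (hε : ε < 1) {w : Fin n → ℝ}
    (hw : w ∈ weights n ε) : 0 < ∑ i, w i := by
  have hn' : (0 : ℝ) < n := Nat.cast_pos.2 hn
  have h1 : ∑ i : Fin n, (1 / (n : ℝ) - w i) ≤ ε :=
    (Finset.sum_le_sum fun i _ => by rw [← neg_sub]; exact neg_le_abs _).trans hw.2
  rw [Finset.sum_sub_distrib] at h1
  simp only [Finset.sum_const, Finset.card_univ, Fintype.card_fin, nsmul_eq_mul] at h1
  rw [mul_one_div_cancel hn'.ne'] at h1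
  linarith

end HuberLocation

theorem mainTheorem4 :
    ∃ C K : ℝ, 0 < C ∧ 0 < K ∧
      ∀ (d n : ℕ) (α ε δ : ℝ), 0 < α → 0 < ε → ε ≤ α / 100 → 0 < δ → δ < 1 →
        (2 ≤ d ∨ δ ≤ 1 / 2) →
        C * ((d : ℝ) * Real.log d / α ^ 4 + Real.log (1 / δ) / α ^ 2) ≤ (n : ℝ) →
        ∀ (D : Measure (EuclideanSpace ℝ (Fin d))) [IsProbabilityMeasure D],
          HuberLocation.IsSemiProduct α 1 D →
          ∀ μstar : EuclideanSpace ℝ (Fin d),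
            -- the set of noise samples `η ∼ D^n` for which the claim fails has probability `≤ δ`
            Measure.pi (fun _ : Fin n => D)
              {η | ¬ ∀ y : Fin n → EuclideanSpace ℝ (Fin d),
                HuberLocation.IsCorruption ε (fun i => μstar + η i) y →
                ∀ w ∈ HuberLocation.weights n ε,
                  (∃ μhat, HuberLocation.IsMinimizer 2 y w μhat) ∧
                  ∀ μhat, HuberLocation.IsMinimizer 2 y w μhat →
                    ‖μhat - μstar‖ ≤
                      K * (√(((d : ℝ) * Real.log d + Real.log (1 / δ)) / (α ^ 2 * (n : ℝ)))
                        + α ^ (-(3 / 2) : ℝ) *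
                          √(ε * (HuberLocation.specNorm
                                  (HuberLocation.clippedCov 2 y w μhat -
                                    HuberLocation.noiseCov 2 D)
                                + ε * Real.log (1 / ε))))}
              ≤ ENNReal.ofReal δ := by
  -- With `T ≤ 8L`, the constant `80000` gives `T / n ≤ (α / 100)²`, that is `τ ≤ α / 100`. Since
  -- `√8 ≤ 3`, the factor `150` on `τ / α` becomes `450`.
  refine ⟨80000, 450, by norm_num, by norm_num, ?_⟩
  intro d n α ε δ hα hε hεα hδ hδ1 hdδ hnC D _ hD μstar
  -- In dimension `0` there is no coordinate from which to deduce `α ≤ 1`, but the claim is trivial.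
  rcases Nat.eq_zero_or_pos d with rfl | hd
  · refine le_trans (le_of_eq ?_) zero_le
    convert measure_empty (μ := Measure.pi fun _ : Fin n => D)
    refine Set.eq_empty_iff_forall_notMem.2 fun η hη => hη ?_
    intro y _ w _
    refine ⟨⟨0, fun ν => by rw [Subsingleton.elim ν 0]⟩, fun μhat _ => ?_⟩
    rw [Subsingleton.elim (μhat - μstar) 0, norm_zero]
    positivity
  have hα1 : α ≤ 1 := (hD.small ⟨0, hd⟩).trans measureReal_le_one
  have hd1 : (1 : ℝ) ≤ d := by exact_mod_cast hd
  have hδ0 : 0 < Real.log (1 / δ) := Real.log_pos (by rw [lt_div_iff₀ hδ]; linarith)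
  have hdlog : 0 ≤ (d : ℝ) * Real.log d := mul_nonneg (by linarith) (Real.log_nonneg hd1)
  set L := (d : ℝ) * Real.log d + Real.log (1 / δ) with hL
  have hL0 : 0 < L := by linarith
  have hnL : 80000 * (L / α ^ 2) ≤ n := by
    refine le_trans ?_ hnC
    rw [hL, add_div]
    have hpow : α ^ 4 ≤ α ^ 2 := pow_le_pow_of_le_one hα.le hα1 (by norm_num)
    gcongr
  have hn' : (0 : ℝ) < n := lt_of_lt_of_le (by positivity) hnL
  have hn : 0 < n := Nat.cast_pos.1 hn'
  -- `T` solves `5 · 25 ^ d · exp (-T) = δ`, and `τ` is chosen so that `n τ² = T`.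
  set T := d * Real.log 25 + Real.log (5 / δ) with hT
  have hTL : T ≤ 8 * L := HuberLocation.log_union_le hd hδ hδ1 hdδ
  have hT0 : 0 < T := by
    have h1 : 0 < Real.log 25 := Real.log_pos (by norm_num)
    have h2 : 0 < Real.log (5 / δ) := Real.log_pos (by rw [lt_div_iff₀ hδ]; linarith)
    positivity
  set τ := √(T / n) with hτdef
  have hτ0 : 0 < τ := Real.sqrt_pos.2 (by positivity)
  have hτsq : τ ^ 2 = T / n := Real.sq_sqrt (by positivity)
  have hτL : τ / α ≤ 3 * √(L / (α ^ 2 * n)) := by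
    have h1 : 3 * √(L / (α ^ 2 * n)) = √(9 * (L / n)) / α := by
      rw [show L / (α ^ 2 * n) = L / n / α ^ 2 by field_simp, Real.sqrt_div (by positivity),
        Real.sqrt_sq hα.le, Real.sqrt_mul (by norm_num),
        show (9 : ℝ) = 3 ^ 2 by norm_num, Real.sqrt_sq (by norm_num)]
      ring
    rw [h1]
    refine div_le_div_of_nonneg_right (Real.sqrt_le_sqrt ?_) hα.le
    rw [← mul_div_assoc]
    exact div_le_div_of_nonneg_right (by linarith) hn'.le
  have hτα : τ ≤ α / 100 := by
    refine Real.sqrt_le_iff.2 ⟨by positivity, ?_⟩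
    rw [div_le_iff₀ hn']
    have h1 : 80000 * L ≤ n * α ^ 2 := by
      rwa [← mul_div_assoc, div_le_iff₀ (by positivity)] at hnL
    linarith
  have hlog : 1 ≤ Real.log (1 / ε) := by
    rw [Real.le_log_iff_exp_le (by positivity), le_div_iff₀ hε]
    nlinarith [Real.exp_one_lt_d9]
  have hδT : 5 * 25 ^ d * Real.exp (-(n * τ ^ 2)) ≤ δ := by
    have e1 : (n : ℝ) * τ ^ 2 = T := by rw [hτsq]; field_simp
    rw [e1, hT, Real.exp_neg, Real.exp_add, Real.exp_nat_mul, Real.exp_log (by norm_num),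
      Real.exp_log (by positivity)]
    refine le_of_eq ?_
    field_simp
  refine (measure_mono ?_).trans
    (hD.measure_not_isRegular_le hn hε hlog hτ0 (by linarith) hδT)
  intro η hη hreg
  refine hη fun y hy w hw => ⟨HuberLocation.exists_isMinimizer y (fun i => (hw.1 i).1)
    (HuberLocation.sum_weights_pos hn (by linarith) hw), fun μhat hmin => ?_⟩
  refine (hreg.norm_sub_le hD hn hα hα1 hε hlog hτ0 hτα hεα hy hw hmin).trans ?_
  have h0 : 0 ≤ α ^ (-(3 / 2) : ℝ) * √(ε * (HuberLocation.specNorm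
      (HuberLocation.clippedCov 2 y w μhat - HuberLocation.noiseCov 2 D)
        + ε * Real.log (1 / ε))) := by positivity
  linarith
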